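/- For a metric space $X$, let $\mathrm{UW}_1(X)\in[0,\infty]$ denote its 1-dimensional Uryson width: the infimal $\varepsilon$ such that there is a continuous map $f\colon X\to Y$ to a $1$-dimensional simplicial complex $Y$ each of whose fibers $f^{-1}(y)$ has diameter at most $\varepsilon$. Let $X$ be a connected compact Riemannian polyhedron, that is, a connected finite simplicial complex whose simplices carry smooth Riemannian metrics (smooth up to the boundary) that agree on common faces, with the induced length metric. Let $\widetilde X$ be the universal cover of $X$ with the lifted length metric. If $\pi_1(X)$ is virtually cyclic (that is, it has a cyclic subgroup of finite index), then \[\mathrm{UW}_1(X)\;\le\; 6\cdot \mathrm{UW}_1(\widetilde X).\] -/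

import Mathlib

open scoped ENNReal ContDiff

universe u w

noncomputable section

/-- The closed simplex spanned by the finite set `s` of vertices, in barycentric coordinates. -/
def closedSimplex {V : Type u} (s : Finset V) : Set (V → ℝ) :=
  {x | (∀ v, 0 ≤ x v) ∧ (∀ v, v ∉ s → x v = 0) ∧ ∑ v ∈ s, x v = 1}

/-- The tangent space of the simplex spanned by `s`: vectors supported on `s` with coordinate
sum zero. -/
def simplexTangent {V : Type u} (s : Finset V) : Set (V → ℝ) :=
  {v | (∀ i, i ∉ s → v i = 0) ∧ ∑ i ∈ s, v i = 0}

/-- The geometric realization of an abstract simplicial complex: the union of the closed simplices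
spanned by its faces. -/
def Realization {V : Type u} (K : AbstractSimplicialComplex V) : Type u :=
  {x : V → ℝ // ∃ s ∈ K, x ∈ closedSimplex s}

/-- The inclusion of a closed simplex into the geometric realization. -/
def simplexInclusion {V : Type u} (K : AbstractSimplicialComplex V) (s : {s : Finset V // s ∈ K})
    (x : closedSimplex s.1) : Realization K :=
  ⟨x.1, s.1, s.2, x.2⟩

/-- The realization carries the weak topology: a set is open iff its intersection with every closed
simplex is open in that simplex. -/
instance Realization.topologicalSpace {V : Type u} (K : AbstractSimplicialComplex V) :
    TopologicalSpace (Realization K) :=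
  ⨆ s : {s : Finset V // s ∈ K}, TopologicalSpace.coinduced (simplexInclusion K s) inferInstance

/-- The `k`-dimensional Uryson width of a (pseudo-, extended) metric space `X`: the infimal `ε` such
that there is a continuous map from `X` to a simplicial complex of dimension at most `k` all of
whose fibers have diameter at most `ε`. It is `∞` if there is no such map for finite `ε`. -/
def urysonWidth (k : ℕ) (X : Type u) [PseudoEMetricSpace X] : ℝ≥0∞ :=
  sInf {ε : ℝ≥0∞ | ∃ (W : Type u) (L : AbstractSimplicialComplex W),
    (∀ s ∈ L, s.card ≤ k + 1) ∧
      ∃ f : X → Realization L, Continuous f ∧ ∀ y, Metric.ediam (f ⁻¹' {y}) ≤ ε}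

/-- A piecewise smooth Riemannian metric on a finite simplicial complex: a Riemannian metric on
every closed simplex, smooth up to the boundary, such that the metrics of a simplex and of its faces
agree on vectors tangent to the face. Only the values `inner s x v w` for a face `s`, a point `x` of
the closed simplex and vectors `v`, `w` tangent to it are used. -/
structure RiemannianMetricOn {V : Type u} [Fintype V] (K : AbstractSimplicialComplex V) where
  inner : Finset V → (V → ℝ) → LinearMap.BilinForm ℝ (V → ℝ)
  symm : ∀ s ∈ K, ∀ x ∈ closedSimplex s, ∀ v ∈ simplexTangent s, ∀ w ∈ simplexTangent s,
    inner s x v w = inner s x w v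
  pos : ∀ s ∈ K, ∀ x ∈ closedSimplex s, ∀ v ∈ simplexTangent s, v ≠ 0 → 0 < inner s x v v
  smooth : ∀ s ∈ K, ∀ v ∈ simplexTangent s, ∀ w ∈ simplexTangent s,
    ContDiffOn ℝ ∞ (fun x => inner s x v w) (closedSimplex s)
  compat : ∀ s ∈ K, ∀ t ∈ K, t ⊆ s → ∀ x ∈ closedSimplex t,
    ∀ v ∈ simplexTangent t, ∀ w ∈ simplexTangent t, inner s x v w = inner t x v w

/-- The barycentric coordinates at time `t` of the image under `p` of a path in `E`. -/
def pathCoords {V : Type u} {K : AbstractSimplicialComplex V} {E : Type w} [TopologicalSpace E]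
    (p : E → Realization K) {a b : E} (γ : Path a b) (t : ℝ) : V → ℝ :=
  (p (γ.extend t)).1

theorem pathCoords_symm {V : Type u} {K : AbstractSimplicialComplex V} {E : Type w}
    [TopologicalSpace E] (p : E → Realization K) {a b : E} (γ : Path a b) :
    pathCoords p γ.symm = fun t => pathCoords p γ (1 - t) := by
  funext t
  simp [pathCoords, Path.extend_symm]

namespace RiemannianMetricOn

variable {V : Type u} [Fintype V] {K : AbstractSimplicialComplex V} (g : RiemannianMetricOn K)
  {E : Type w} [TopologicalSpace E] (p : E → Realization K)

/-- The length, with respect to the metric of the simplex `s`, of a curve `c : [0, 1] → |s|`. -/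
def simplexLength (s : Finset V) (c : ℝ → V → ℝ) : ℝ :=
  ∫ t in (0 : ℝ)..1, √(g.inner s (c t)
    (derivWithin c (Set.Icc 0 1) t) (derivWithin c (Set.Icc 0 1) t))

/-- `g.IsSegmentLength p a b ℓ`: there is a path in `E` from `a` to `b` whose image under `p` is a
`C¹` curve of length `ℓ` inside a single closed simplex. -/
def IsSegmentLength (a b : E) (ℓ : ℝ≥0∞) : Prop :=
  ∃ (γ : Path a b) (s : Finset V), s ∈ K ∧
    (∀ t ∈ Set.Icc (0 : ℝ) 1, pathCoords p γ t ∈ closedSimplex s) ∧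
    ContDiffOn ℝ 1 (pathCoords p γ) (Set.Icc 0 1) ∧
    ℓ = ENNReal.ofReal (g.simplexLength s (pathCoords p γ))

/-- `g.IsPathLength p a b ℓ`: there is a path in `E` from `a` to `b`, a finite concatenation of
paths as in `IsSegmentLength`, whose image under `p` (a piecewise `C¹` path) has length `ℓ`. -/
inductive IsPathLength : E → E → ℝ≥0∞ → Prop
  | refl (a : E) : IsPathLength a a 0
  | cons {a b c : E} {ℓ ℓ' : ℝ≥0∞} : g.IsSegmentLength p a b ℓ → IsPathLength b c ℓ' →
      IsPathLength a c (ℓ + ℓ')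

variable {g p}

theorem IsSegmentLength.symm {a b : E} {ℓ : ℝ≥0∞} (h : g.IsSegmentLength p a b ℓ) :
    g.IsSegmentLength p b a ℓ := by
  obtain ⟨γ, s, hs, hmem, hC, rfl⟩ := h
  have hmaps : Set.MapsTo (fun t : ℝ => 1 - t) (Set.Icc 0 1) (Set.Icc 0 1) := by
    intro t ht
    exact ⟨by linarith [ht.2], by linarith [ht.1]⟩
  refine ⟨γ.symm, s, hs, ?_, ?_, ?_⟩
  · intro t ht
    rw [pathCoords_symm]
    exact hmem _ (hmaps ht)
  · rw [pathCoords_symm]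
    exact hC.comp (contDiff_const.sub contDiff_id).contDiffOn hmaps
  · congr 1
    rw [pathCoords_symm]
    set c := pathCoords p γ with hc
    have key : ∀ t ∈ Set.Icc (0 : ℝ) 1, derivWithin (fun t => c (1 - t)) (Set.Icc 0 1) t =
        -derivWithin c (Set.Icc 0 1) (1 - t) := by
      intro t ht
      have h1 : HasDerivWithinAt c (derivWithin c (Set.Icc 0 1) (1 - t)) (Set.Icc 0 1) (1 - t) :=
        ((hC.differentiableOn one_ne_zero) _ (hmaps ht)).hasDerivWithinAt
      have h2 : HasDerivWithinAt (fun t : ℝ => 1 - t) (-1) (Set.Icc 0 1) t := by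
        simpa using (hasDerivWithinAt_id t (Set.Icc (0 : ℝ) 1)).const_sub 1
      have h3 := h1.scomp t h2 hmaps
      simpa [Function.comp_def] using
        h3.derivWithin (uniqueDiffOn_Icc zero_lt_one t ht)
    unfold simplexLength
    have := intervalIntegral.integral_comp_sub_left (a := 0) (b := 1)
      (fun t => √(g.inner s (c t) (derivWithin c (Set.Icc 0 1) t)
        (derivWithin c (Set.Icc 0 1) t))) 1
    simp only [sub_self, sub_zero] at this
    rw [← this]
    refine intervalIntegral.integral_congr fun t ht => ?_
    rw [Set.uIcc_of_le zero_le_one] at ht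
    simp [key t ht]

theorem IsPathLength.trans {a b c : E} {ℓ ℓ' : ℝ≥0∞} (h : g.IsPathLength p a b ℓ)
    (h' : g.IsPathLength p b c ℓ') : g.IsPathLength p a c (ℓ + ℓ') := by
  induction h with
  | refl => simpa using h'
  | cons hs _ ih => rw [add_assoc]; exact .cons hs (ih h')

theorem IsPathLength.symm {a b : E} {ℓ : ℝ≥0∞} (h : g.IsPathLength p a b ℓ) :
    g.IsPathLength p b a ℓ := by
  induction h with
  | refl a => exact .refl a
  | cons hs _ ih =>
    rw [add_comm]
    have := IsPathLength.cons hs.symm (.refl _)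
    rw [add_zero] at this
    exact ih.trans this

variable (g p)

/-- The space `E` with the length metric pulled back along `p : E → |K|`: the distance is the
infimum of the lengths of the piecewise `C¹` paths. For `p = id` this is the Riemannian polyhedron
`(K, g)` itself; for a covering map `p` it is the covering space with the lifted metric. In both
cases this metric induces the given topology of `E`. -/
@[nolint unusedArguments]
def LengthSpace (_g : RiemannianMetricOn K) (_p : E → Realization K) : Type w := E

instance LengthSpace.pseudoEMetricSpace : PseudoEMetricSpace (g.LengthSpace p) where
  edist (a b : E) := sInf {ℓ | g.IsPathLength p a b ℓ}
  edist_self (a : E) := le_antisymm (sInf_le (IsPathLength.refl a)) zero_le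
  edist_comm (a b : E) := by
    congr 1
    ext ℓ
    exact ⟨IsPathLength.symm, IsPathLength.symm⟩
  edist_triangle (a b c : E) := by
    rw [ENNReal.sInf_add]
    refine le_iInf₂ fun ℓ hℓ => ?_
    rw [add_comm, ENNReal.sInf_add]
    refine le_iInf₂ fun ℓ' hℓ' => ?_
    rw [add_comm]
    exact sInf_le (hℓ.trans hℓ')

end RiemannianMetricOn

/-- A group is virtually cyclic if it has a cyclic subgroup of finite index (equivalently, it is
finite or virtually `ℤ`). -/
def IsVirtuallyCyclic (G : Type u) [Group G] : Prop :=
  ∃ H : Subgroup G, IsCyclic H ∧ H.FiniteIndex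

end

/-! ### Medians of finite families separated by the fibers of a map to a graph -/

/-! Let `f` map the universal cover `E` to a graph with fibers of diameter at most `w`. The map on
`X` comes from the distance to one well chosen point `p c`: cover `X` by the path components of thin
slabs of this function. At most two slabs overlap, so the nerve is a graph (`exists_nerve_map`), and
it remains to bound the diameter of a slab component. A path in it lifts to a connected set `Z` in
`E` at nearly constant distance `r` from the orbit `P` of `c`. If `r` is below about `2w`, the
triangle inequality through `p c` suffices.

Since `E` is simply connected, `f` behaves like a map to a tree: every finite family of points has a
median fiber, whose complement joins no strict majority of them (`exists_median_fiber`). For three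
points this is a fiber meeting every path between two of them.

Call two points of `P` equivalent if they are joined off the union of the fibers that meet `Z`. If
`z₁`, `z₂` in `Z` have nearest orbit points that are equivalent, a median fiber gives distance at
most `3w`, up to a small error (`IsSlab.dist_le_of_joinedIn`). If at most two classes occur along
`Z`, connectedness gives a point of `Z` near both classes, hence the bound `6w = 3w + 3w`
(`IsSlab.dist_le`).

That there are at most two classes is where virtual cyclicity enters. The center `c` is chosen so
that a ball of radius slightly above `w` around it is a median of the orbit: no component of its
complement holds more than half of a finite orbit, or the ball separates the two ends of an infinite
one. If among three far apart translates of the ball none separated the other two, there would be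
three disjoint sets, each with half of the orbit or a tail towards one of only two ends, which is
impossible (`IsLengthDist.separates_of_big`). Hence one ball separates the other two centers, and
this forces an equivalence among the three.

The remaining work shows that length metrics on `X` and `E` fit this abstract setting: balls are
open, bounded sets of `E` lie in compact sets, and distances to `p c` are realized by lifts. -/

theorem exists_real_lift {E : Type*} [TopologicalSpace E] [SimplyConnectedSpace E]
    [LocallyPathConnectedSpace E] {θ : E → AddCircle (1 : ℝ)} (hθ : Continuous θ) :
    ∃ φ : E → ℝ, Continuous φ ∧ ∀ x, (φ x : AddCircle (1 : ℝ)) = θ x := by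
  obtain ⟨a⟩ : Nonempty E := inferInstance
  obtain ⟨t, ht⟩ := QuotientAddGroup.mk_surjective (θ a)
  obtain ⟨F, ⟨-, hF⟩, -⟩ := (AddCircle.isCoveringMap_coe (1 : ℝ)).existsUnique_continuousMap_lifts
    ⟨θ, hθ⟩ a t ht
  exact ⟨F, F.continuous, fun x => congrFun hF x⟩

theorem addCircle_coe_eq_zero_iff {t : ℝ} : (t : AddCircle (1 : ℝ)) = 0 ↔ ∃ n : ℤ, (n : ℝ) = t := by
  rw [AddCircle.coe_eq_zero_iff]
  simp

theorem IsPreconnected.eq_of_coe_eq_zero {E : Type*} [TopologicalSpace E] {C : Set E}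
    (hC : IsPreconnected C) {φ : E → ℝ} (hφ : Continuous φ)
    (h : ∀ x ∈ C, (φ x : AddCircle (1 : ℝ)) = 0) {x y : E} (hx : x ∈ C) (hy : y ∈ C) :
    φ x = φ y := by
  have key : ∀ x ∈ C, ∀ y ∈ C, ¬ φ x < φ y := by
    intro x hx y hy hlt
    obtain ⟨m, hm⟩ := addCircle_coe_eq_zero_iff.1 (h x hx)
    obtain ⟨n, hn⟩ := addCircle_coe_eq_zero_iff.1 (h y hy)
    have hmn : m < n := by
      rw [← hm, ← hn] at hlt
      exact_mod_cast hlt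
    have hmn' : (m : ℝ) + 1 ≤ n := by exact_mod_cast hmn
    obtain ⟨z, hz, hzv⟩ := hC.intermediate_value hx hy hφ.continuousOn
      (show (m : ℝ) + 1 / 2 ∈ Set.Icc (φ x) (φ y) from ⟨by linarith, by linarith⟩)
    obtain ⟨l, hl⟩ := addCircle_coe_eq_zero_iff.1 (h z hz)
    have h1 : (m : ℝ) < l := by linarith
    have h2 : (l : ℝ) < m + 1 := by linarith
    have h1' : m < l := by exact_mod_cast h1
    have h2' : l < m + 1 := by exact_mod_cast h2
    omega
  exact le_antisymm (not_lt.1 (key y hy x hx)) (not_lt.1 (key x hx y hy))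

/-- The position on the edge with barycentric coordinates `a`, `b`, as a point of the circle
obtained by collapsing everything outside the open edge. -/
noncomputable def edgeAngle (a b : ℝ) : AddCircle (1 : ℝ) :=
  if b ≤ a then ((min a b : ℝ) : AddCircle (1 : ℝ)) else ((-min a b : ℝ) : AddCircle (1 : ℝ))

/-- The definition by `min` makes continuity visible; this form is the one to compute with. Its real
representative jumps by `1` at the end of the edge where `b = 1`, which is invisible in the circle.
-/
theorem edgeAngle_eq {a b : ℝ} (ha : 0 ≤ a) (hb : 0 ≤ b) (h : a ≠ 0 → b ≠ 0 → a + b = 1) :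
    edgeAngle a b = ((if a = 0 then 0 else b : ℝ) : AddCircle (1 : ℝ)) := by
  unfold edgeAngle
  rcases eq_or_ne a 0 with rfl | ha'
  · simp [min_eq_left hb]
  rcases eq_or_ne b 0 with rfl | hb'
  · simp [ha]
  have hab := h ha' hb'
  rw [if_neg ha']
  split_ifs with hle
  · rw [min_eq_right hle]
  · rw [min_eq_left (not_le.1 hle).le, show -a = b - 1 by linarith, AddCircle.coe_sub,
      AddCircle.coe_period, sub_zero]

theorem edgeAngle_add_swap {a b : ℝ} (ha : 0 ≤ a) (hb : 0 ≤ b) (h : a ≠ 0 → b ≠ 0 → a + b = 1) :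
    edgeAngle a b + edgeAngle b a = 0 := by
  rw [edgeAngle_eq ha hb h, edgeAngle_eq hb ha fun h1 h2 => by rw [add_comm]; exact h h2 h1]
  rcases eq_or_ne a 0 with rfl | ha'
  · simp
  rcases eq_or_ne b 0 with rfl | hb'
  · simp
  rw [if_neg ha', if_neg hb', ← AddCircle.coe_add, add_comm, h ha' hb', AddCircle.coe_period]

theorem continuous_edgeAngle {E : Type*} [TopologicalSpace E] {f g : E → ℝ} (hf : Continuous f)
    (hg : Continuous g) (h : ∀ x, f x ≠ 0 → g x ≠ 0 → f x + g x = 1) :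
    Continuous fun x => edgeAngle (f x) (g x) := by
  have hq : Continuous ((↑) : ℝ → AddCircle (1 : ℝ)) := AddCircle.continuous_mk' 1
  refine Continuous.if_le (hq.comp (hf.min hg)) (hq.comp (hf.min hg).neg) hg hf ?_
  intro x hx
  simp only [hx, min_self]
  rcases eq_or_ne (f x) 0 with h' | h'
  · simp [h']
  · have := h x h' (hx ▸ h')
    rw [show f x = 1 / 2 by linarith, show (-(1 / 2) : ℝ) = 1 / 2 - 1 by norm_num,
      AddCircle.coe_sub, AddCircle.coe_period, sub_zero]

open Classical in
/-- If every non-integer has a strict majority of the values strictly on one side, then some integer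
has a strict majority weakly above it and a strict majority weakly below it. -/
theorem exists_integer_median {ι : Type*} [Fintype ι] [Nonempty ι] (v : ι → ℝ)
    (h : ∀ t : ℝ, (t : AddCircle (1 : ℝ)) ≠ 0 →
      Fintype.card ι < 2 * (Finset.univ.filter fun k => t < v k).card ∨
      Fintype.card ι < 2 * (Finset.univ.filter fun k => v k < t).card) :
    ∃ N : ℤ, Fintype.card ι < 2 * (Finset.univ.filter fun k => (N : ℝ) ≤ v k).card ∧
      Fintype.card ι < 2 * (Finset.univ.filter fun k => v k ≤ N).card := by
  have hn : 0 < Fintype.card ι := Fintype.card_pos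
  have compl1 : ∀ t : ℝ, (Finset.univ.filter fun k => t < v k).card +
      (Finset.univ.filter fun k => v k ≤ t).card = Fintype.card ι := by
    intro t
    have := Finset.card_filter_add_card_filter_not (s := (Finset.univ : Finset ι))
      (fun k => t < v k)
    simpa using this
  have compl2 : ∀ t : ℝ, (Finset.univ.filter fun k => v k < t).card +
      (Finset.univ.filter fun k => t ≤ v k).card = Fintype.card ι := by
    intro t
    have := Finset.card_filter_add_card_filter_not (s := (Finset.univ : Finset ι))
      (fun k => v k < t)
    simpa using this
  let T : Finset ι := Finset.univ.filter fun k =>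
    Fintype.card ι < 2 * (Finset.univ.filter fun l => v l ≤ v k).card
  have hT : T.Nonempty := by
    obtain ⟨k, -, hk⟩ := Finset.exists_max_image Finset.univ v Finset.univ_nonempty
    refine ⟨k, ?_⟩
    simp only [T, Finset.mem_filter, Finset.mem_univ, true_and]
    rw [Finset.filter_true_of_mem fun l _ => hk l (Finset.mem_univ l), Finset.card_univ]
    omega
  obtain ⟨k, hkT, hkmin⟩ := Finset.exists_min_image T v hT
  have hk : Fintype.card ι < 2 * (Finset.univ.filter fun l => v l ≤ v k).card := by
    simpa [T] using hkT
  have hlt : ¬ Fintype.card ι < 2 * (Finset.univ.filter fun l => v l < v k).card := by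
    intro hcon
    have hne : (Finset.univ.filter fun l => v l < v k).Nonempty := by
      rw [← Finset.card_pos]; omega
    obtain ⟨j, hj, hjmax⟩ := Finset.exists_max_image _ v hne
    have hjk : v j < v k := by simpa using hj
    refine absurd (hkmin j ?_) (not_le.2 hjk)
    simp only [T, Finset.mem_filter, Finset.mem_univ, true_and]
    refine hcon.trans_le (Nat.mul_le_mul_left _ (Finset.card_le_card fun l hl => ?_))
    simpa using hjmax l hl
  -- Neither strict side of the lowest weak-majority value `v k` has a majority, so the hypothesis
  -- can only fail to apply because `v k` is an integer.
  have hint : ((v k : ℝ) : AddCircle (1 : ℝ)) = 0 := by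
    by_contra hne
    have h1 := compl1 (v k)
    rcases h (v k) hne with h' | h' <;> omega
  obtain ⟨N, hN⟩ := addCircle_coe_eq_zero_iff.1 hint
  refine ⟨N, ?_, hN ▸ hk⟩
  rw [hN]
  by_contra hcon
  -- A non-integer `t` so close below `N` that no value lies in `[t, N)`; being above `t` then means
  -- being at least `N`.
  obtain ⟨t, ht1, ht2, ht3⟩ : ∃ t : ℝ, (N : ℝ) - 1 < t ∧ t < N ∧ ∀ l, v l < N → v l < t := by
    rcases (Finset.univ.filter fun l => v l < N).eq_empty_or_nonempty with he | hne
    · refine ⟨N - 1 / 2, by linarith, by linarith, fun l hl => ?_⟩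
      have hl' : l ∈ Finset.univ.filter fun l => v l < N := by simpa using hl
      simp [he] at hl'
    · obtain ⟨j, hj, hjmax⟩ := Finset.exists_max_image _ v hne
      have hjN : v j < N := by simpa using hj
      have hm : max (v j) (N - 1 : ℝ) < N := max_lt hjN (by linarith)
      obtain ⟨t, ht1, ht2⟩ := exists_between hm
      refine ⟨t, (le_max_right _ _).trans_lt ht1, ht2, fun l hl => ?_⟩
      exact (hjmax l (by simpa using hl)).trans_lt ((le_max_left _ _).trans_lt ht1)
  have htne : ((t : ℝ) : AddCircle (1 : ℝ)) ≠ 0 := by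
    intro h0
    obtain ⟨m, hm⟩ := addCircle_coe_eq_zero_iff.1 h0
    rw [← hm] at ht1 ht2
    have h1 : N - 1 < m := by exact_mod_cast ht1
    have h2 : m < N := by exact_mod_cast ht2
    omega
  rcases h t htne with h' | h'
  · refine hcon (h'.trans_le (Nat.mul_le_mul_left _ (Finset.card_le_card fun l hl => ?_)))
    simp only [Finset.mem_filter, Finset.mem_univ, true_and] at hl ⊢
    by_contra hc
    exact absurd (ht3 l (by rw [hN]; exact not_le.1 hc)) (not_lt.2 hl.le)
  · refine hlt (h'.trans_le (Nat.mul_le_mul_left _ (Finset.card_le_card fun l hl => ?_)))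
    simp only [Finset.mem_filter, Finset.mem_univ, true_and] at hl ⊢
    exact hl.trans (by rw [← hN]; exact ht2)

theorem exists_mem_of_two_majorities {ι : Type*} [Fintype ι] {S T : Finset ι}
    (hS : Fintype.card ι < 2 * S.card) (hT : Fintype.card ι < 2 * T.card) : ∃ k, k ∈ S ∧ k ∈ T := by
  classical
  by_contra hcon
  push Not at hcon
  have hd : Disjoint S T := Finset.disjoint_left.2 hcon
  have := Finset.card_union_of_disjoint hd
  have h2 := Finset.card_le_univ (S ∪ T)
  omega

theorem exists_eq_int_add_of_coe_eq_edgeAngle {a b t : ℝ} (ha : 0 ≤ a) (hb : 0 ≤ b)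
    (h : a ≠ 0 → b ≠ 0 → a + b = 1) (ht : (t : AddCircle (1 : ℝ)) = edgeAngle a b) :
    ∃ m : ℤ, t = m + if a = 0 ∨ b = 0 then 0 else b := by
  rw [edgeAngle_eq ha hb h, ← sub_eq_zero, ← AddCircle.coe_sub] at ht
  obtain ⟨m, hm⟩ := addCircle_coe_eq_zero_iff.1 ht
  refine ⟨m, ?_⟩
  rw [hm]
  by_cases ha0 : a = 0
  · simp [ha0]
  by_cases hb0 : b = 0
  · simp [hb0]
  · simp [ha0, hb0]

section
variable {E : Type*} [TopologicalSpace E] [SimplyConnectedSpace E] [LocallyPathConnectedSpace E]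

open Classical in
/-- A real valued function that parametrizes the edge with barycentric coordinates `a` and `b`, is
locally constant off it, and has a weak majority of the points `A k` on either side of `0`. -/
theorem exists_edge_coordinate {a b : E → ℝ} (ha : Continuous a) (hb : Continuous b)
    (ha0 : ∀ x, 0 ≤ a x) (hb0 : ∀ x, 0 ≤ b x) (hab : ∀ x, a x ≠ 0 → b x ≠ 0 → a x + b x = 1)
    {ι : Type*} [Fintype ι] [Nonempty ι] (A : ι → E)
    (H : ∀ s ∈ Set.Ioo (0 : ℝ) 1, ∃ C : Set E, IsPreconnected C ∧
      (∀ x ∈ C, ¬ (a x = 1 - s ∧ b x = s)) ∧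
      Fintype.card ι < 2 * (Finset.univ.filter fun k => A k ∈ C).card) :
    ∃ φ : E → ℝ, Continuous φ ∧ (∀ x, (φ x : AddCircle (1 : ℝ)) = edgeAngle (a x) (b x)) ∧
      Fintype.card ι < 2 * (Finset.univ.filter fun k => 0 ≤ φ (A k)).card ∧
      Fintype.card ι < 2 * (Finset.univ.filter fun k => φ (A k) ≤ 0).card := by
  obtain ⟨φ, hφ, hlift⟩ := exists_real_lift (continuous_edgeAngle ha hb hab)
  obtain ⟨N, hN1, hN2⟩ := exists_integer_median (fun k => φ (A k)) (by
    intro t ht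
    have hfr : Int.fract t ∈ Set.Ioo (0 : ℝ) 1 := by
      refine ⟨lt_of_le_of_ne (Int.fract_nonneg t) fun h0 => ht ?_, Int.fract_lt_one t⟩
      -- The level set `φ = t` at a non-integer `t` lies over the single edge point with parameter
      -- `Int.fract t`, which `C` avoids.
      exact addCircle_coe_eq_zero_iff.2 ⟨⌊t⌋, by linarith [Int.floor_add_fract t]⟩
    obtain ⟨C, hC, hav, hcard⟩ := H _ hfr
    have hne : ∀ x ∈ C, φ x ≠ t := by
      intro x hx heq
      have h1 := hlift x
      rw [heq, edgeAngle_eq (ha0 x) (hb0 x) (hab x)] at h1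
      have ha' : a x ≠ 0 := fun h0 => ht (by rw [h1, if_pos h0]; simp)
      have hb' : b x ≠ 0 := fun h0 => ht (by rw [h1, if_neg ha', h0]; simp)
      have hsum := hab x ha' hb'
      rw [if_neg ha', ← sub_eq_zero, ← AddCircle.coe_sub] at h1
      obtain ⟨n, hn⟩ := addCircle_coe_eq_zero_iff.1 h1
      have hpa : 0 < a x := lt_of_le_of_ne (ha0 x) (Ne.symm ha')
      have hpb : 0 < b x := lt_of_le_of_ne (hb0 x) (Ne.symm hb')
      have hfl : n = ⌊t⌋ := by
        symm
        rw [Int.floor_eq_iff]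
        constructor <;> linarith
      have : b x = Int.fract t := by
        rw [Int.fract, ← hfl]; linarith
      exact hav x hx ⟨by linarith, this⟩
    have hside : (∀ x ∈ C, t < φ x) ∨ ∀ x ∈ C, φ x < t := by
      by_contra hcon
      push Not at hcon
      obtain ⟨⟨x, hx, hxt⟩, y, hy, hyt⟩ := hcon
      obtain ⟨z, hz, hzt⟩ := hC.intermediate_value hx hy hφ.continuousOn ⟨hxt, hyt⟩
      exact hne z hz hzt
    refine hside.imp ?_ ?_ <;> intro hs <;>
      exact hcard.trans_le (Nat.mul_le_mul_left _ (Finset.card_le_card fun k hk => by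
        simp only [Finset.mem_filter, Finset.mem_univ, true_and] at hk ⊢
        exact hs _ hk)))
  refine ⟨fun x => φ x - N, hφ.sub continuous_const, fun x => ?_, ?_, ?_⟩
  · rw [AddCircle.coe_sub, hlift, addCircle_coe_eq_zero_iff.2 ⟨N, rfl⟩, sub_zero]
  · simpa using hN1
  · simpa using hN2

open Classical in
/-- A partition of unity whose nerve is a graph, on a simply connected space, cannot be oriented
towards the majority of a finite family of points. -/
theorem false_of_majorities {J : Type*} [Fintype J] {ρ : J → E → ℝ} (hρ : ∀ j, Continuous (ρ j))
    (h0 : ∀ j x, 0 ≤ ρ j x) (hle1 : ∀ j x, ρ j x ≤ 1)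
    (hpair : ∀ i j x, i ≠ j → ρ i x ≠ 0 → ρ j x ≠ 0 → ρ i x + ρ j x = 1)
    {S : Set E} (hS : IsPreconnected S) (hsum : ∀ x ∈ S, ∑ j, ρ j x = 1)
    {ι : Type*} [Fintype ι] [Nonempty ι] (A : ι → E) (hA : ∀ k, A k ∈ S)
    (H1 : ∀ i, ∃ C : Set E, IsPreconnected C ∧ (∀ x ∈ C, ρ i x ≠ 1) ∧
      Fintype.card ι < 2 * (Finset.univ.filter fun k => A k ∈ C).card)
    (H2 : ∀ i j, i ≠ j → ∀ s ∈ Set.Ioo (0 : ℝ) 1, ∃ C : Set E, IsPreconnected C ∧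
      (∀ x ∈ C, ¬ (ρ i x = 1 - s ∧ ρ j x = s)) ∧
      Fintype.card ι < 2 * (Finset.univ.filter fun k => A k ∈ C).card) : False := by
  have hex : ∀ i j, ∃ φ : E → ℝ, i ≠ j → Continuous φ ∧
      (∀ x, (φ x : AddCircle (1 : ℝ)) = edgeAngle (ρ i x) (ρ j x)) ∧
      Fintype.card ι < 2 * (Finset.univ.filter fun k => 0 ≤ φ (A k)).card ∧
      Fintype.card ι < 2 * (Finset.univ.filter fun k => φ (A k) ≤ 0).card := by
    intro i j
    by_cases hij : i = j
    · exact ⟨0, fun h => absurd hij h⟩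
    · obtain ⟨φ, hφ⟩ := exists_edge_coordinate (hρ i) (hρ j) (h0 i) (h0 j)
        (fun x => hpair i j x hij) A (H2 i j hij)
      exact ⟨φ, fun _ => hφ⟩
  choose φ hφ using hex
  -- The sum is a constant integer. Two strict majorities share an index, so the normalization of
  -- both lifts forces it to be nonnegative and nonpositive.
  have hanti : ∀ i j, i ≠ j → ∀ x, φ i j x + φ j i x = 0 := by
    intro i j hij
    obtain ⟨hc, hl, hge, hle⟩ := hφ i j hij
    obtain ⟨hc', hl', hge', hle'⟩ := hφ j i hij.symm
    have hconst : ∀ x y, φ i j x + φ j i x = φ i j y + φ j i y := by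
      intro x y
      refine isPreconnected_univ.eq_of_coe_eq_zero (hc.add hc') (fun z _ => ?_)
        (Set.mem_univ x) (Set.mem_univ y)
      simp only [Pi.add_apply]
      rw [AddCircle.coe_add, hl, hl']
      exact edgeAngle_add_swap (h0 i z) (h0 j z) (hpair i j z hij)
    obtain ⟨k, hk, hk'⟩ := exists_mem_of_two_majorities hge hge'
    obtain ⟨l, hl, hl'⟩ := exists_mem_of_two_majorities hle hle'
    simp only [Finset.mem_filter, Finset.mem_univ, true_and] at hk hk' hl hl'
    intro x
    have e1 := hconst x (A k)
    have e2 := hconst x (A l)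
    linarith
  -- A divergence at the vertex `i`. Modulo `1` it is `0` where `ρ i = 0` and `∑ ρ = 1` elsewhere,
  -- so it is a constant integer on the connected set `S`; that integer is read off at a point `A k`
  -- in the majority set `C` avoiding the vertex.
  have hD : ∀ i, ∀ x ∈ S, ρ i x + ∑ j ∈ Finset.univ.erase i, φ i j x = 0 := by
    intro i
    have hcont : Continuous fun x => ρ i x + ∑ j ∈ Finset.univ.erase i, φ i j x :=
      (hρ i).add (continuous_finsetSum _ fun j hj => (hφ i j (Finset.ne_of_mem_erase hj).symm).1)
    have hcoe : ∀ x ∈ S,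
        ((ρ i x + ∑ j ∈ Finset.univ.erase i, φ i j x : ℝ) : AddCircle (1 : ℝ)) = 0 := by
      intro x hx
      have h1 : ((∑ j ∈ Finset.univ.erase i, φ i j x : ℝ) : AddCircle (1 : ℝ)) =
          ((∑ j ∈ Finset.univ.erase i, if ρ i x = 0 then 0 else ρ j x : ℝ) :
            AddCircle (1 : ℝ)) := by
        change (QuotientAddGroup.mk' _) _ = (QuotientAddGroup.mk' _) _
        rw [map_sum, map_sum]
        refine Finset.sum_congr rfl fun j hj => ?_
        have hij := (Finset.ne_of_mem_erase hj).symm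
        exact ((hφ i j hij).2.1 x).trans (edgeAngle_eq (h0 i x) (h0 j x) (hpair i j x hij))
      rw [AddCircle.coe_add, h1, ← AddCircle.coe_add]
      by_cases hz : ρ i x = 0
      · simp [hz]
      · simp only [hz, if_false]
        rw [Finset.add_sum_erase _ (fun j => ρ j x) (Finset.mem_univ i), hsum x hx,
          AddCircle.coe_period]
    obtain ⟨C, hC, hav, hcard⟩ := H1 i
    have hCne : ∃ k, A k ∈ C := by
      have : 0 < (Finset.univ.filter fun k => A k ∈ C).card := by omega
      obtain ⟨k, hk⟩ := Finset.card_pos.1 this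
      exact ⟨k, by simpa using hk⟩
    -- Values just above an integer `n` occur only on the edge next to `i`, where `φ i j - n + ρ i =
    -- 1`. Passing from `≤ n` to `> n` would therefore require a point with `ρ i = 1`, which `C`
    -- avoids.
    have hside : ∀ j, i ≠ j → ∀ n : ℤ, (∀ x ∈ C, φ i j x ≤ n) ∨ ∀ x ∈ C, (n : ℝ) < φ i j x := by
      intro j hij n
      obtain ⟨hc, hl, -, -⟩ := hφ i j hij
      by_contra hcon
      push Not at hcon
      obtain ⟨⟨x, hx, hxn⟩, y, hy, hyn⟩ := hcon
      have hopen : ∃ U V : Set E, IsOpen U ∧ IsOpen V ∧ (∀ z ∈ C, (n : ℝ) < φ i j z → z ∈ U) ∧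
          (∀ z ∈ C, φ i j z ≤ n → z ∈ V) ∧ ∀ z, z ∈ U → z ∉ V := by
        refine ⟨{z | (n : ℝ) < φ i j z}, {z | φ i j z < n} ∪
          {z | φ i j z < n + 1 ∧ φ i j z - n + ρ i z < 1},
          isOpen_lt continuous_const hc, (isOpen_lt hc continuous_const).union
            ((isOpen_lt hc continuous_const).inter
              (isOpen_lt ((hc.sub continuous_const).add (hρ i)) continuous_const)),
          fun z _ h => h, ?_, ?_⟩
        · intro z hz hle
          rcases hle.lt_or_eq with h | h
          · exact Or.inl h
          · refine Or.inr ⟨by rw [h]; linarith, ?_⟩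
            have : ρ i z ≠ 1 := hav z hz
            rw [h, sub_self, zero_add]
            exact lt_of_le_of_ne (hle1 i z) this
        · rintro z hz (h | ⟨h1, h2⟩)
          · have h' : φ i j z < n := h
            have hz' : (n : ℝ) < φ i j z := hz
            linarith
          · have hz' : (n : ℝ) < φ i j z := hz
            obtain ⟨m, hm⟩ := exists_eq_int_add_of_coe_eq_edgeAngle (h0 i z) (h0 j z)
              (hpair i j z hij) (hl z)
            rw [hm] at hz' h1 h2
            split_ifs at hz' h1 h2 with hz0
            · rw [add_zero] at hz' h1
              have e1 : n < m := by exact_mod_cast hz'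
              have e2 : m < n + 1 := by exact_mod_cast h1
              omega
            · push Not at hz0
              have := hpair i j z hij hz0.1 hz0.2
              have hj1 := hle1 j z
              have e1 : (n : ℝ) < m + 1 := by linarith
              have e2 : (m : ℝ) < n := by linarith
              have e1' : n < m + 1 := by exact_mod_cast e1
              have e2' : m < n := by exact_mod_cast e2
              omega
      obtain ⟨U, V, hU, hV, hCU, hCV, hd⟩ := hopen
      obtain ⟨z, hz, hzU, hzV⟩ := hC U V hU hV (fun z hz => by
        rcases le_or_gt (φ i j z) n with h | h
        exacts [Or.inr (hCV z hz h), Or.inl (hCU z hz h)]) ⟨x, hx, hCU x hx hxn⟩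
        ⟨y, hy, hCV y hy hyn⟩
      exact hd z hzU hzV
    -- The normalization of `φ i j` meets the majority in `C` on both sides, so `hside` at `0` and
    -- `-1` traps the values in `(-1, 0]`.
    have hval : ∀ x ∈ C, ∀ j, i ≠ j → φ i j x = if ρ i x = 0 ∨ ρ j x = 0 then 0 else ρ j x - 1 := by
      intro x hx j hij
      obtain ⟨hc, hl, hge, hle⟩ := hφ i j hij
      have hub : φ i j x ≤ 0 := by
        rcases hside j hij 0 with h | h
        · exact_mod_cast h x hx
        · obtain ⟨k, hk, hk'⟩ := exists_mem_of_two_majorities hcard hle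
          simp only [Finset.mem_filter, Finset.mem_univ, true_and] at hk hk'
          have := h _ hk
          push_cast at this
          linarith
      have hlb : -1 < φ i j x := by
        rcases hside j hij (-1) with h | h
        · obtain ⟨k, hk, hk'⟩ := exists_mem_of_two_majorities hcard hge
          simp only [Finset.mem_filter, Finset.mem_univ, true_and] at hk hk'
          have := h _ hk
          push_cast at this
          linarith
        · exact_mod_cast h x hx
      obtain ⟨m, hm⟩ := exists_eq_int_add_of_coe_eq_edgeAngle (h0 i x) (h0 j x)
        (hpair i j x hij) (hl x)
      rw [hm] at hub hlb ⊢
      split_ifs at hub hlb ⊢ with hz0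
      · rw [add_zero] at hub hlb
        have e1 : m ≤ 0 := by exact_mod_cast hub
        have e2 : -1 < m := by exact_mod_cast hlb
        have : m = 0 := by omega
        simp [this]
      · push Not at hz0
        have hp : 0 < ρ j x := lt_of_le_of_ne (h0 j x) (Ne.symm hz0.2)
        have hj1 := hle1 j x
        have e1 : (m : ℝ) < 0 := by linarith
        have e2 : (-2 : ℝ) < m := by linarith
        have e1' : m < 0 := by exact_mod_cast e1
        have e2' : -2 < m := by exact_mod_cast e2
        have : m = -1 := by omega
        rw [this]
        push_cast
        ring
    obtain ⟨k, hk⟩ := hCne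
    intro x hx
    refine (hS.eq_of_coe_eq_zero hcont hcoe hx (hA k)).trans ?_
    rw [Finset.sum_congr rfl fun j hj => hval (A k) hk j (Finset.ne_of_mem_erase hj).symm]
    have hs := hsum (A k) (hA k)
    rw [← Finset.add_sum_erase _ (fun j => ρ j (A k)) (Finset.mem_univ i)] at hs
    by_cases hz : ρ i (A k) = 0
    · simp [hz]
    have hne1 := hav (A k) hk
    obtain ⟨j, hj, hj0⟩ := Finset.exists_ne_zero_of_sum_ne_zero
      (show ∑ j ∈ Finset.univ.erase i, ρ j (A k) ≠ 0 from fun h => hne1 (by linarith))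
    have hij := hpair i j (A k) (Finset.ne_of_mem_erase hj).symm hz hj0
    have hrest : ∀ l ∈ (Finset.univ.erase i).erase j, ρ l (A k) = 0 := by
      refine (Finset.sum_eq_zero_iff_of_nonneg fun l _ => h0 l (A k)).1 ?_
      have := Finset.add_sum_erase _ (fun j => ρ j (A k)) hj
      linarith
    rw [Finset.sum_eq_single j (fun l hl hlj => if_pos (Or.inr
        (hrest l (Finset.mem_erase.2 ⟨hlj, hl⟩)))) (fun h => absurd hj h),
      if_neg (by push Not; exact ⟨hz, hj0⟩)]
    linarith
  obtain ⟨k⟩ : Nonempty ι := inferInstance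
  -- Summing the divergences over all vertices gives the contradiction: the `ρ` terms add up to `1`,
  -- and the `φ` terms cancel in pairs by `hanti`.
  have htot : ∑ i, (ρ i (A k) + ∑ j ∈ Finset.univ.erase i, φ i j (A k)) = 0 :=
    Finset.sum_eq_zero fun i _ => hD i _ (hA k)
  rw [Finset.sum_add_distrib, hsum _ (hA k)] at htot
  have hF : ∀ i, ∑ j ∈ Finset.univ.erase i, φ i j (A k) =
      ∑ j, if i = j then 0 else φ i j (A k) := by
    intro i
    rw [← Finset.add_sum_erase _ (fun j => if i = j then 0 else φ i j (A k)) (Finset.mem_univ i),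
      if_pos rfl, zero_add]
    exact Finset.sum_congr rfl fun j hj => (if_neg (Finset.ne_of_mem_erase hj).symm).symm
  simp_rw [hF] at htot
  have hswap : ∑ i, ∑ j, ((if i = j then 0 else φ i j (A k)) +
      (if j = i then 0 else φ j i (A k))) = 0 := by
    refine Finset.sum_eq_zero fun i _ => Finset.sum_eq_zero fun j _ => ?_
    by_cases hij : i = j
    · simp [hij]
    · rw [if_neg hij, if_neg (Ne.symm hij), hanti i j hij]
  simp_rw [Finset.sum_add_distrib] at hswap
  rw [Finset.sum_comm (f := fun i j => if j = i then 0 else φ j i (A k))] at hswap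
  linarith
end

/-! ### Coordinates and compact sets in the weak topology of a realization -/

namespace Realization

variable {W : Type*} {L : AbstractSimplicialComplex W}

theorem continuous_dom_iff {Z : Type*} [TopologicalSpace Z] {f : Realization L → Z} :
    Continuous f ↔ ∀ s : {s : Finset W // s ∈ L}, Continuous (f ∘ simplexInclusion L s) := by
  rw [continuous_iSup_dom]
  exact forall_congr' fun s => continuous_coinduced_dom

theorem continuous_simplexInclusion (s : {s : Finset W // s ∈ L}) :
    Continuous (simplexInclusion L s) :=
  continuous_dom_iff.1 continuous_id s

theorem isOpen_iff {U : Set (Realization L)} :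
    IsOpen U ↔ ∀ s : {s : Finset W // s ∈ L}, IsOpen (simplexInclusion L s ⁻¹' U) := by
  rw [isOpen_iSup_iff]
  exact forall_congr' fun s => isOpen_coinduced

theorem continuous_val : Continuous (fun y : Realization L => y.1) :=
  continuous_dom_iff.2 fun _ => continuous_subtype_val

theorem continuous_coord (v : W) : Continuous (fun y : Realization L => y.1 v) :=
  (continuous_apply v).comp continuous_val

theorem coord_nonneg (y : Realization L) (v : W) : 0 ≤ y.1 v := by
  obtain ⟨s, -, hy⟩ := y.2
  exact hy.1 v

theorem sum_coord_le_one (y : Realization L) (T : Finset W) : ∑ v ∈ T, y.1 v ≤ 1 := by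
  classical
  obtain ⟨s, -, hy⟩ := y.2
  calc ∑ v ∈ T, y.1 v ≤ ∑ v ∈ T ∪ s, y.1 v :=
        Finset.sum_le_sum_of_subset_of_nonneg Finset.subset_union_left fun v _ _ => hy.1 v
    _ = ∑ v ∈ s, y.1 v :=
        (Finset.sum_subset Finset.subset_union_right fun v _ hv => hy.2.1 v hv).symm
    _ = 1 := hy.2.2

theorem coord_le_one (y : Realization L) (v : W) : y.1 v ≤ 1 := by
  simpa using sum_coord_le_one y {v}

theorem coord_eq_zero_of_sum_eq_one {y : Realization L} {T : Finset W} (hT : ∑ v ∈ T, y.1 v = 1)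
    {v : W} (hv : v ∉ T) : y.1 v = 0 := by
  classical
  have := sum_coord_le_one y (insert v T)
  rw [Finset.sum_insert hv, hT] at this
  exact le_antisymm (by linarith) (coord_nonneg y v)

theorem ext_of_sum_eq_one {y z : Realization L} {T : Finset W} (hy : ∑ v ∈ T, y.1 v = 1)
    (h : ∀ v ∈ T, y.1 v = z.1 v) : y = z := by
  refine Subtype.ext (funext fun v => ?_)
  by_cases hv : v ∈ T
  · exact h v hv
  · rw [coord_eq_zero_of_sum_eq_one hy hv,
      coord_eq_zero_of_sum_eq_one ((Finset.sum_congr rfl h).symm.trans hy) hv]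

theorem add_coord_eq_one (hL : ∀ s ∈ L, s.card ≤ 2) (y : Realization L) {i j : W} (hij : i ≠ j)
    (hi : y.1 i ≠ 0) (hj : y.1 j ≠ 0) : y.1 i + y.1 j = 1 := by
  classical
  obtain ⟨s, hs, hy⟩ := y.2
  have his : i ∈ s := by_contra fun h => hi (hy.2.1 i h)
  have hjs : j ∈ s := by_contra fun h => hj (hy.2.1 j h)
  have hsub : ({i, j} : Finset W) ⊆ s := by
    intro v hv
    simp only [Finset.mem_insert, Finset.mem_singleton] at hv
    rcases hv with rfl | rfl <;> assumption
  have hs' : {i, j} = s := Finset.eq_of_subset_of_card_le hsub (by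
    rw [Finset.card_pair hij]; exact hL s hs)
  have := hy.2.2
  rwa [← hs', Finset.sum_pair hij] at this

/-- The weak topology allows arbitrary, even unbounded, coefficients, because only finitely many
coordinates live on each simplex. -/
theorem continuous_finsum_mul (c : W → ℝ) :
    Continuous fun y : Realization L => ∑ᶠ v, c v * y.1 v := by
  refine continuous_dom_iff.2 fun s => ?_
  have : ((fun y : Realization L => ∑ᶠ v, c v * y.1 v) ∘ simplexInclusion L s) =
      fun x => ∑ v ∈ s.1, c v * x.1 v := by
    funext x
    refine finsum_eq_sum_of_support_subset _ fun v hv => ?_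
    by_contra h
    exact hv (by simp [simplexInclusion, x.2.2.1 v h])
  rw [this]
  exact continuous_finsetSum _ fun v _ =>
    continuous_const.mul ((continuous_apply v).comp continuous_subtype_val)

/-- Given infinitely many such vertices, weights that make the `n`th one contribute `n` at its own
point of `S` define a continuous function that is unbounded on `S`. -/
theorem finite_vertices_of_isCompact {S : Set (Realization L)} (hS : IsCompact S) :
    {v | ∃ y ∈ S, y.1 v ≠ 0}.Finite := by
  classical
  by_contra hinf
  let e := Set.Infinite.natEmbedding _ hinf
  have he : ∀ n, ∃ y ∈ S, y.1 (e n).1 ≠ 0 := fun n => (e n).2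
  choose y hyS hy using he
  let c : W → ℝ := Function.extend (fun n => (e n).1) (fun n => n / (y n).1 (e n).1) 0
  have hinj : Function.Injective fun n => (e n).1 :=
    Subtype.val_injective.comp e.injective
  have hce : ∀ n, c (e n).1 = n / (y n).1 (e n).1 := fun n => hinj.extend_apply _ _ n
  have hc0 : ∀ v, 0 ≤ c v := by
    intro v
    by_cases hv : ∃ n, (e n).1 = v
    · obtain ⟨n, rfl⟩ := hv
      rw [hce]
      exact div_nonneg n.cast_nonneg (coord_nonneg _ _)
    · simp [c, Function.extend_apply' _ _ _ hv]
  obtain ⟨B, hB⟩ := (hS.image (continuous_finsum_mul c)).bddAbove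
  obtain ⟨n, hn⟩ := exists_nat_gt B
  have h1 : ∑ᶠ v, c v * (y n).1 v ≤ B := hB ⟨y n, hyS n, rfl⟩
  obtain ⟨s, -, hs⟩ := (y n).2
  have h2 : ∑ᶠ v, c v * (y n).1 v = ∑ v ∈ s, c v * (y n).1 v := by
    refine finsum_eq_sum_of_support_subset _ fun v hv => ?_
    by_contra h
    exact hv (by simp [hs.2.1 v h])
  have hmem : (e n).1 ∈ s := by_contra fun h => hy n (hs.2.1 _ h)
  have h3 : c (e n).1 * (y n).1 (e n).1 ≤ ∑ v ∈ s, c v * (y n).1 v :=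
    Finset.single_le_sum (f := fun v => c v * (y n).1 v)
      (fun v _ => mul_nonneg (hc0 v) (hs.1 v)) hmem
  rw [hce, div_mul_cancel₀ _ (hy n)] at h3
  linarith

end Realization

/-! ### Median fibers -/

/-- A map from a simply connected space to a graph has a fiber that is a median of a given finite
family of points: no strict majority of them is joined in the complement. -/
theorem exists_median_fiber {E : Type*} [TopologicalSpace E] [SimplyConnectedSpace E]
    [LocallyPathConnectedSpace E] {W : Type*} {L : AbstractSimplicialComplex W}
    (hL : ∀ s ∈ L, s.card ≤ 2) {f : E → Realization L} (hf : Continuous f)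
    {ι : Type*} [Fintype ι] [Nonempty ι] (A : ι → E) :
    ∃ y, ∀ M : Finset ι, (∀ k ∈ M, ∀ l ∈ M, JoinedIn (f ⁻¹' {y})ᶜ (A k) (A l)) →
      2 * M.card ≤ Fintype.card ι := by
  classical
  by_contra! hcon
  obtain ⟨k₀⟩ : Nonempty ι := inferInstance
  have hn : 0 < Fintype.card ι := Fintype.card_pos
  have hmaj : ∀ T : Set E, (∀ x ∈ T, ∀ x' ∈ T, f x = f x') → ∃ C : Set E, IsPreconnected C ∧
      (∀ x ∈ C, x ∉ T) ∧ Fintype.card ι < 2 * (Finset.univ.filter fun k => A k ∈ C).card := by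
    intro T hT
    rcases T.eq_empty_or_nonempty with rfl | ⟨x₀, hx₀⟩
    · refine ⟨Set.univ, isPreconnected_univ, fun x _ h => h, ?_⟩
      simp only [Set.mem_univ, Finset.filter_true, Finset.card_univ]
      omega
    · obtain ⟨M, hM, hcard⟩ := hcon (f x₀)
      have hMne : M.Nonempty := by rw [← Finset.card_pos]; omega
      obtain ⟨k, hk⟩ := hMne
      refine ⟨pathComponentIn (f ⁻¹' {f x₀})ᶜ (A k),
        (isPathConnected_pathComponentIn (hM k hk k hk).source_mem).isConnected.isPreconnected,
        fun x hx hxT => ?_, hcard.trans_le (Nat.mul_le_mul_left _ (Finset.card_le_card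
          fun l hl => ?_))⟩
      · exact pathComponentIn_subset hx (hT x hxT x₀ hx₀)
      · exact Finset.mem_filter.2 ⟨Finset.mem_univ l, hM k hk l hl⟩
  -- The graph may be infinite. A compact connected set through all `A k` involves finitely many
  -- vertices, and the coordinates need to sum to `1` only there.
  let S : Set E := ⋃ k, Set.range (PathConnectedSpace.somePath (A k₀) (A k))
  have hScomp : IsCompact S := isCompact_iUnion fun k => isCompact_range (Path.continuous _)
  have hSconn : IsPreconnected S := by
    refine isPreconnected_iUnion ⟨A k₀, Set.mem_iInter.2 fun k => ⟨0, Path.source _⟩⟩ fun k => ?_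
    exact isPreconnected_range (Path.continuous _)
  have hA : ∀ k, A k ∈ S := fun k => Set.mem_iUnion.2 ⟨k, 1, Path.target _⟩
  have hfin := Realization.finite_vertices_of_isCompact (hScomp.image hf)
  have : Fintype {v | ∃ y ∈ f '' S, y.1 v ≠ 0} := hfin.fintype
  refine false_of_majorities (J := {v | ∃ y ∈ f '' S, y.1 v ≠ 0})
    (ρ := fun j x => (f x).1 j) (fun j => (Realization.continuous_coord j.1).comp hf)
    (fun j x => Realization.coord_nonneg _ _) (fun j x => Realization.coord_le_one _ _)
    (fun i j x hij => Realization.add_coord_eq_one hL (f x) (fun h => hij (Subtype.ext h)))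
    hSconn ?_ A hA ?_ ?_
  · intro x hx
    obtain ⟨s, -, hs⟩ := (f x).2
    have h1 : ∑ j : {v | ∃ y ∈ f '' S, y.1 v ≠ 0}, (f x).1 j = ∑ v ∈ hfin.toFinset, (f x).1 v :=
      (Finset.sum_subtype _ (fun v => by simp) _).symm
    rw [h1]
    refine le_antisymm (Realization.sum_coord_le_one _ _) ?_
    rw [← hs.2.2, ← Finset.sum_filter_ne_zero]
    refine Finset.sum_le_sum_of_subset_of_nonneg (fun v hv => ?_)
      fun v _ _ => Realization.coord_nonneg _ _
    exact hfin.mem_toFinset.2 ⟨f x, ⟨x, hx, rfl⟩, (Finset.mem_filter.1 hv).2⟩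
  · intro i
    obtain ⟨C, hC, hCT, hcard⟩ := hmaj {x | (f x).1 i = 1} (fun x hx x' hx' =>
      Realization.ext_of_sum_eq_one (T := {i.1}) (by simpa using hx) (by
        intro v hv
        rw [Finset.mem_singleton] at hv
        rw [hv, show (f x).1 i = 1 from hx, show (f x').1 i = 1 from hx']))
    exact ⟨C, hC, hCT, hcard⟩
  · intro i j hij s _
    have hij' : i.1 ≠ j.1 := fun h => hij (Subtype.ext h)
    obtain ⟨C, hC, hCT, hcard⟩ := hmaj {x | (f x).1 i = 1 - s ∧ (f x).1 j = s}
      (fun x hx x' hx' =>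
      Realization.ext_of_sum_eq_one (T := {i.1, j.1})
        (by rw [Finset.sum_pair hij', hx.1, hx.2]; ring) (by
        intro v hv
        simp only [Finset.mem_insert, Finset.mem_singleton] at hv
        rcases hv with rfl | rfl
        · rw [hx.1, hx'.1]
        · rw [hx.2, hx'.2]))
    exact ⟨C, hC, hCT, hcard⟩

/-! ### Abstract length distances and median fibers of three points -/

/-- `D` is a length pseudometric, with open balls: points at distance less than `ℓ` are joined by a
path all of whose points are almost between them. -/
structure IsLengthDist {E : Type*} [TopologicalSpace E] (D : E → E → ℝ) : Prop where
  self : ∀ a, D a a = 0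
  symm : ∀ a b, D a b = D b a
  triangle : ∀ a b c, D a c ≤ D a b + D b c
  isOpen_ball : ∀ a ε, IsOpen {b | D a b < ε}
  exists_path : ∀ {a b ℓ}, D a b < ℓ → ∃ γ : Path a b, ∀ t, D a (γ t) + D (γ t) b < ℓ

namespace IsLengthDist

variable {E : Type*} [TopologicalSpace E] {D : E → E → ℝ}

theorem nonneg (hD : IsLengthDist D) (a b : E) : 0 ≤ D a b := by
  have h1 := hD.triangle a b a
  rw [hD.self, hD.symm b a] at h1
  linarith

theorem continuous (hD : IsLengthDist D) (a : E) : Continuous (D a) := by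
  refine continuous_iff_continuousAt.2 fun x => Metric.continuousAt_iff'.2 fun ε hε => ?_
  have : {y | D x y < ε} ∈ nhds x :=
    (hD.isOpen_ball x ε).mem_nhds (by simpa [hD.self] using hε)
  filter_upwards [this] with y hy
  have hy' : D x y < ε := hy
  rw [Real.dist_eq, abs_lt]
  have h1 := hD.triangle a x y
  have h2 := hD.triangle a y x
  rw [hD.symm y x] at h2
  constructor <;> linarith

theorem joinedIn_ball (hD : IsLengthDist D) {a b : E} {ε : ℝ} (h : D a b < ε) :
    JoinedIn {x | D a x < ε} a b := by
  obtain ⟨γ, hγ⟩ := hD.exists_path h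
  refine ⟨γ, fun t => ?_⟩
  have h1 := hγ t
  have h2 := hD.nonneg (γ t) b
  change D a (γ t) < ε
  linarith

end IsLengthDist

/-- Three points have a fiber meeting every path between two of them. -/
theorem exists_fiber_meeting_paths {E : Type*} [TopologicalSpace E] [SimplyConnectedSpace E]
    [LocallyPathConnectedSpace E] {W : Type*} {L : AbstractSimplicialComplex W}
    (hL : ∀ s ∈ L, s.card ≤ 2) {f : E → Realization L} (hf : Continuous f) (a b c : E) :
    ∃ y, (∀ γ : Path a b, ∃ t, f (γ t) = y) ∧ (∀ γ : Path b c, ∃ t, f (γ t) = y) ∧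
      ∀ γ : Path a c, ∃ t, f (γ t) = y := by
  obtain ⟨y, hy⟩ := exists_median_fiber hL hf ![a, b, c]
  have key : ∀ k l : Fin 3, k ≠ l → ∀ γ : Path (![a, b, c] k) (![a, b, c] l),
      ∃ t, f (γ t) = y := by
    intro k l hkl γ
    by_contra! hcon
    have hj : JoinedIn (f ⁻¹' {y})ᶜ (![a, b, c] k) (![a, b, c] l) := ⟨γ, fun t ht => hcon t ht⟩
    have hk : JoinedIn (f ⁻¹' {y})ᶜ (![a, b, c] k) (![a, b, c] k) := .refl hj.source_mem
    have hl : JoinedIn (f ⁻¹' {y})ᶜ (![a, b, c] l) (![a, b, c] l) := .refl hj.target_mem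
    have := hy {k, l} (by
      intro i hi j hj'
      simp only [Finset.mem_insert, Finset.mem_singleton] at hi hj'
      rcases hi with rfl | rfl <;> rcases hj' with rfl | rfl
      exacts [hk, hj, hj.symm, hl])
    rw [Finset.card_pair hkl, Fintype.card_fin] at this
    omega
  exact ⟨y, key 0 1 (by decide), key 1 2 (by decide), key 0 2 (by decide)⟩

/-! ### Diameter of connected pieces of a slab -/

section
variable {E : Type*} [TopologicalSpace E] {D : E → E → ℝ}
  {T : Type*} {f : E → T} {w δ r : ℝ} {h : E → ℝ} {P Z : Set E}

/-- The data for a slab: `h` is a `1`-Lipschitz function bounded by the distance from `P`, the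
fibers of `f` have diameter at most `w`, and `Z` is a connected set on which `r ≤ h < r + δ`. -/
structure IsSlab (D : E → E → ℝ) (f : E → T) (w δ r : ℝ) (h : E → ℝ) (P Z : Set E) : Prop where
  lengthDist : IsLengthDist D
  fiber : ∀ x y, f x = f y → D x y ≤ w
  le : ∀ x, ∀ q ∈ P, h x ≤ D x q
  lipschitz : ∀ x y, h x ≤ h y + D x y
  exists_near : ∀ {x ℓ}, h x < ℓ → ∃ q ∈ P, D x q < ℓ
  isPathConnected : IsPathConnected Z
  ge : ∀ z ∈ Z, r ≤ h z
  lt : ∀ z ∈ Z, h z < r + δ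

namespace IsSlab

theorem width_nonneg (H : IsSlab D f w δ r h P Z) : 0 ≤ w := by
  obtain ⟨z, -⟩ := H.isPathConnected.nonempty
  simpa [H.lengthDist.self] using H.fiber z z rfl

theorem delta_pos (H : IsSlab D f w δ r h P Z) : 0 < δ := by
  obtain ⟨z, hz⟩ := H.isPathConnected.nonempty
  linarith [H.ge z hz, H.lt z hz]

theorem le_of_mem_saturation (H : IsSlab D f w δ r h P Z) {s : E} (hs : s ∈ f ⁻¹' (f '' Z)) :
    r - w ≤ h s := by
  obtain ⟨z, hz, hzs⟩ := hs
  have h1 := H.lipschitz z s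
  have h2 := H.fiber z s hzs
  linarith [H.ge z hz]

/-- A median fiber of `z₁`, `z₂`, `q₁` meets `Z`, hence avoids the path joining `q₁` to `q₂` and
must meet both almost shortest paths from `z₁` to `q₁` and from `z₂` to `q₂`. There `h ≥ r - w`, so
the meeting points are within `w + δ` of `z₁` and `z₂`, and within `w` of each other. -/
theorem dist_le_of_joinedIn {W : Type*} {L : AbstractSimplicialComplex W} {f : E → Realization L}
    (H : IsSlab D f w δ r h P Z) [SimplyConnectedSpace E] [LocallyPathConnectedSpace E]
    (hL : ∀ s ∈ L, s.card ≤ 2) (hf : Continuous f)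
    {z₁ z₂ q₁ q₂ : E} (hz₁ : z₁ ∈ Z) (hz₂ : z₂ ∈ Z) (hq₁ : q₁ ∈ P) (hq₂ : q₂ ∈ P)
    (h₁ : D z₁ q₁ < r + δ) (h₂ : D z₂ q₂ < r + δ)
    (hj : JoinedIn (f ⁻¹' (f '' Z))ᶜ q₁ q₂) : D z₁ z₂ ≤ 3 * w + 2 * δ := by
  have hD := H.lengthDist
  obtain ⟨ζ, hζ⟩ := H.isPathConnected.joinedIn z₁ hz₁ z₂ hz₂
  obtain ⟨α₁, hα₁⟩ := hD.exists_path h₁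
  obtain ⟨α₂, hα₂⟩ := hD.exists_path h₂
  obtain ⟨β, hβ⟩ := hj
  obtain ⟨y, hy12, hy2, hy1⟩ := exists_fiber_meeting_paths hL hf z₁ z₂ q₁
  obtain ⟨t, ht⟩ := hy12 ζ
  obtain ⟨t₁, ht₁⟩ := hy1 α₁
  obtain ⟨t₂, ht₂⟩ := hy2 (α₂.trans β.symm)
  obtain ⟨u₂, hu₂, hfu₂⟩ : ∃ u, u ∈ Set.range α₂ ∧ f u = y := by
    have hmem : (α₂.trans β.symm) t₂ ∈ Set.range α₂ ∪ Set.range β.symm := by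
      rw [← Path.trans_range]; exact ⟨t₂, rfl⟩
    rcases hmem with hm | hm
    · exact ⟨_, hm, ht₂⟩
    · rw [Path.symm_range] at hm
      obtain ⟨t', ht'⟩ := hm
      refine absurd ?_ (hβ t')
      exact ⟨ζ t, hζ t, by rw [ht, ht', ht₂]⟩
  obtain ⟨t₂', rfl⟩ := hu₂
  have a1 := H.fiber (α₁ t₁) (ζ t) (ht₁.trans ht.symm)
  have a2 := H.fiber (α₂ t₂') (ζ t) (hfu₂.trans ht.symm)
  have a3 := H.fiber (α₁ t₁) (α₂ t₂') (ht₁.trans hfu₂.symm)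
  have b1 := H.lipschitz (ζ t) (α₁ t₁)
  have b2 := H.lipschitz (ζ t) (α₂ t₂')
  rw [hD.symm] at b1 b2
  have c := H.ge _ (hζ t)
  have d1 := H.le (α₁ t₁) q₁ hq₁
  have d2 := H.le (α₂ t₂') q₂ hq₂
  have e1 := hα₁ t₁
  have e2 := hα₂ t₂'
  have g1 := hD.triangle z₁ (α₁ t₁) z₂
  have g2 := hD.triangle (α₁ t₁) (α₂ t₂') z₂
  rw [hD.symm (α₂ t₂') z₂] at g2
  linarith

/-- Since `D z q' ≥ r`, a point `v` within `w + δ` of `q'` has used up more than `r - w - δ` of the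
length from `z` to `q`. Less than `w + 2 * δ` remains, so neither leg from `v` reaches the fibers
meeting `Z`, whose points are at distance at least `r - w ≥ w + 2 * δ` from `P`. -/
theorem joinedIn_of_near (H : IsSlab D f w δ r h P Z) (hr : 2 * w + 2 * δ ≤ r)
    {z q q' v : E} (hz : z ∈ Z) (hq : q ∈ P)
    (hq' : q' ∈ P) (hv : D z v + D v q < r + δ) (hv' : D q' v < w + δ) :
    JoinedIn (f ⁻¹' (f '' Z))ᶜ q q' := by
  have hD := H.lengthDist
  have hw := H.width_nonneg
  have hδ := H.delta_pos
  obtain ⟨α, hα⟩ := hD.exists_path (show D v q < r + δ - D z v by linarith)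
  have j1 : JoinedIn (f ⁻¹' (f '' Z))ᶜ v q := by
    refine ⟨α, fun t ht => ?_⟩
    have h1 := H.le_of_mem_saturation ht
    have h2 := H.le (α t) q hq
    have h3 := hα t
    have h4 := hD.nonneg v (α t)
    have h5 := H.ge z hz
    have h6 := H.le z q' hq'
    have h7 := hD.triangle z v q'
    rw [hD.symm v q'] at h7
    linarith
  obtain ⟨β, hβ⟩ := hD.exists_path hv'
  have j2 : JoinedIn (f ⁻¹' (f '' Z))ᶜ q' v := by
    refine ⟨β, fun t ht => ?_⟩
    have h1 := H.le_of_mem_saturation ht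
    have h2 := H.le (β t) q' hq'
    rw [hD.symm] at h2
    have h3 := hβ t
    have h4 := hD.nonneg (β t) v
    linarith
  exact (j2.trans j1).symm

/-- A point of an almost shortest path on a fiber meeting `Z` would be at distance at least `w + 2 *
δ` from both ends. -/
theorem joinedIn_of_dist_lt (H : IsSlab D f w δ r h P Z) (hr : 2 * w + 2 * δ ≤ r)
    {q q' : E} (hq : q ∈ P) (hq' : q' ∈ P)
    (hd : D q q' < 2 * w + 3 * δ) : JoinedIn (f ⁻¹' (f '' Z))ᶜ q q' := by
  have hD := H.lengthDist
  have hδ := H.delta_pos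
  obtain ⟨α, hα⟩ := hD.exists_path hd
  refine ⟨α, fun t ht => ?_⟩
  have h1 := H.le_of_mem_saturation ht
  have h2 := H.le (α t) q hq
  have h3 := H.le (α t) q' hq'
  rw [hD.symm] at h2
  have h4 := hα t
  linarith

/-- Apply the separation to the path from `q₁` to `z₁`, through `Z` to `z₃`, and on to `q₃`. It
cannot hit the ball on `Z`, where `h ≥ r`, so it does so on an outer leg and `joinedIn_of_near`
applies. -/
theorem joinedIn_or_of_separates (H : IsSlab D f w δ r h P Z) (hr : 2 * w + 2 * δ ≤ r)
    {z₁ z₃ q₁ q₂ q₃ : E} (hz₁ : z₁ ∈ Z)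
    (hz₃ : z₃ ∈ Z) (hq₁ : q₁ ∈ P) (hq₂ : q₂ ∈ P) (hq₃ : q₃ ∈ P) (h₁ : D z₁ q₁ < r + δ)
    (h₃ : D z₃ q₃ < r + δ) (hsep : ∀ γ : Path q₁ q₃, ∃ t, D q₂ (γ t) < w + δ) :
    JoinedIn (f ⁻¹' (f '' Z))ᶜ q₁ q₂ ∨ JoinedIn (f ⁻¹' (f '' Z))ᶜ q₃ q₂ := by
  have hD := H.lengthDist
  have hw := H.width_nonneg
  have hδ := H.delta_pos
  obtain ⟨ζ, hζ⟩ := H.isPathConnected.joinedIn z₁ hz₁ z₃ hz₃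
  obtain ⟨α₁, hα₁⟩ := hD.exists_path h₁
  obtain ⟨α₃, hα₃⟩ := hD.exists_path h₃
  obtain ⟨t, ht⟩ := hsep (α₁.symm.trans (ζ.trans α₃))
  have hmem : (α₁.symm.trans (ζ.trans α₃)) t ∈
      Set.range α₁ ∪ (Set.range ζ ∪ Set.range α₃) := by
    rw [← Path.trans_range, ← Path.symm_range α₁, ← Path.trans_range]; exact ⟨t, rfl⟩
  rcases hmem with ⟨t', ht'⟩ | ⟨t', ht'⟩ | ⟨t', ht'⟩
  · exact Or.inl (H.joinedIn_of_near hr hz₁ hq₁ hq₂ (hα₁ t') (ht' ▸ ht))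
  · rw [← ht'] at ht
    have h1 := H.ge _ (hζ t')
    have h2 := H.le (ζ t') q₂ hq₂
    rw [hD.symm] at h2
    linarith
  · exact Or.inr (H.joinedIn_of_near hr hz₃ hq₃ hq₂ (hα₃ t') (ht' ▸ ht))

/-- A connected piece of a slab has diameter at most `6 * w`, up to a small error, if among any
three far apart points of `P` the ball around one separates the other two. -/
theorem dist_le {W : Type*} {L : AbstractSimplicialComplex W} {f : E → Realization L}
    (H : IsSlab D f w δ r h P Z) [SimplyConnectedSpace E] [LocallyPathConnectedSpace E]
    (hL : ∀ s ∈ L, s.card ≤ 2) (hf : Continuous f) (hr : 2 * w + 2 * δ ≤ r)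
    (hsep : ∀ q₁ ∈ P, ∀ q₂ ∈ P, ∀ q₃ ∈ P, 2 * w + 3 * δ ≤ D q₁ q₂ → 2 * w + 3 * δ ≤ D q₁ q₃ →
      2 * w + 3 * δ ≤ D q₂ q₃ → (∀ γ : Path q₂ q₃, ∃ t, D q₁ (γ t) < w + δ) ∨
      (∀ γ : Path q₁ q₃, ∃ t, D q₂ (γ t) < w + δ) ∨ ∀ γ : Path q₁ q₂, ∃ t, D q₃ (γ t) < w + δ)
    {z₁ z₂ : E} (hz₁ : z₁ ∈ Z) (hz₂ : z₂ ∈ Z) : D z₁ z₂ ≤ 6 * w + 4 * δ := by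
  have hD := H.lengthDist
  have hw := H.width_nonneg
  have hδ := H.delta_pos
  -- At most two classes of orbit points occur near `Z`.
  have hthree : ∀ z₁ ∈ Z, ∀ z₂ ∈ Z, ∀ z₃ ∈ Z, ∀ q₁ ∈ P, ∀ q₂ ∈ P, ∀ q₃ ∈ P, D z₁ q₁ < r + δ →
      D z₂ q₂ < r + δ → D z₃ q₃ < r + δ → JoinedIn (f ⁻¹' (f '' Z))ᶜ q₁ q₂ ∨
      JoinedIn (f ⁻¹' (f '' Z))ᶜ q₃ q₁ ∨ JoinedIn (f ⁻¹' (f '' Z))ᶜ q₃ q₂ := by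
    intro z₁ hz₁ z₂ hz₂ z₃ hz₃ q₁ hq₁ q₂ hq₂ q₃ hq₃ h₁ h₂ h₃
    rcases lt_or_ge (D q₁ q₂) (2 * w + 3 * δ) with h12 | h12
    · exact Or.inl (H.joinedIn_of_dist_lt hr hq₁ hq₂ h12)
    rcases lt_or_ge (D q₁ q₃) (2 * w + 3 * δ) with h13 | h13
    · exact Or.inr (Or.inl (H.joinedIn_of_dist_lt hr hq₁ hq₃ h13).symm)
    rcases lt_or_ge (D q₂ q₃) (2 * w + 3 * δ) with h23 | h23
    · exact Or.inr (Or.inr (H.joinedIn_of_dist_lt hr hq₂ hq₃ h23).symm)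
    rcases hsep q₁ hq₁ q₂ hq₂ q₃ hq₃ h12 h13 h23 with hs | hs | hs
    · rcases H.joinedIn_or_of_separates hr hz₂ hz₃ hq₂ hq₁ hq₃ h₂ h₃ hs with hj | hj
      exacts [Or.inl hj.symm, Or.inr (Or.inl hj)]
    · rcases H.joinedIn_or_of_separates hr hz₁ hz₃ hq₁ hq₂ hq₃ h₁ h₃ hs with hj | hj
      exacts [Or.inl hj, Or.inr (Or.inr hj)]
    · rcases H.joinedIn_or_of_separates hr hz₁ hz₂ hq₁ hq₃ hq₂ h₁ h₂ hs with hj | hj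
      exacts [Or.inr (Or.inl hj.symm), Or.inr (Or.inr hj.symm)]
  obtain ⟨q₁, hq₁, h₁⟩ := H.exists_near (H.lt z₁ hz₁)
  obtain ⟨q₂, hq₂, h₂⟩ := H.exists_near (H.lt z₂ hz₂)
  by_cases hj : JoinedIn (f ⁻¹' (f '' Z))ᶜ q₁ q₂
  · linarith [H.dist_le_of_joinedIn hL hf hz₁ hz₂ hq₁ hq₂ h₁ h₂ hj]
  have hopen : ∀ q' : E,
      IsOpen {z | ∃ q ∈ P, D q z < r + δ ∧ JoinedIn (f ⁻¹' (f '' Z))ᶜ q q'} := by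
    intro q'
    have : {z | ∃ q ∈ P, D q z < r + δ ∧ JoinedIn (f ⁻¹' (f '' Z))ᶜ q q'} =
        ⋃ q ∈ {q | q ∈ P ∧ JoinedIn (f ⁻¹' (f '' Z))ᶜ q q'}, {z | D q z < r + δ} := by
      ext z
      simp only [Set.mem_ofPred_eq, Set.mem_iUnion, exists_prop]
      exact ⟨fun ⟨q, h1, h2, h3⟩ => ⟨q, ⟨h1, h3⟩, h2⟩, fun ⟨q, ⟨h1, h3⟩, h2⟩ => ⟨q, h1, h2, h3⟩⟩
    rw [this]
    exact isOpen_biUnion fun q _ => hD.isOpen_ball q _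
  have hout : ∀ q ∈ P, ∀ z ∈ Z, D z q < r + δ → q ∉ f ⁻¹' (f '' Z) := by
    intro q hq z hz _ hmem
    have h1 := H.le_of_mem_saturation hmem
    have h2 := H.le q q hq
    rw [hD.self] at h2
    linarith
  -- The points of `Z` near the class of `q₁` and those near the class of `q₂` form two open sets
  -- covering the connected set `Z`. At a common point the `3 * w` bound is used twice, which is the
  -- source of the constant `6`.
  obtain ⟨z, hz, ⟨q, hq, hqz, hqj⟩, q', hq', hqz', hqj'⟩ :=
    H.isPathConnected.isConnected.isPreconnected _ _ (hopen q₁) (hopen q₂) (fun z hz => by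
      obtain ⟨q, hq, hqz⟩ := H.exists_near (H.lt z hz)
      rcases hthree z₁ hz₁ z₂ hz₂ z hz q₁ hq₁ q₂ hq₂ q hq h₁ h₂ hqz with h' | h' | h'
      · exact absurd h' hj
      · exact Or.inl ⟨q, hq, by rwa [hD.symm], h'⟩
      · exact Or.inr ⟨q, hq, by rwa [hD.symm], h'⟩)
      ⟨z₁, hz₁, q₁, hq₁, by rwa [hD.symm], .refl (hout q₁ hq₁ z₁ hz₁ h₁)⟩
      ⟨z₂, hz₂, q₂, hq₂, by rwa [hD.symm], .refl (hout q₂ hq₂ z₂ hz₂ h₂)⟩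
  rw [hD.symm] at hqz hqz'
  have e1 := H.dist_le_of_joinedIn hL hf hz₁ hz hq₁ hq h₁ hqz hqj.symm
  have e2 := H.dist_le_of_joinedIn hL hf hz hz₂ hq' hq₂ hqz' h₂ hqj'
  have := hD.triangle z₁ z z₂
  linarith

end IsSlab
end

/-! ### Separation by far apart translates of a ball -/

theorem Path.joinedIn_image_Icc {E : Type*} [TopologicalSpace E] {a b : E} (τ : Path a b) {t : ℝ}
    (ht : 0 ≤ t) : JoinedIn (τ.extend '' Set.Icc 0 t) a (τ.extend t) := by
  have h := ((convex_Icc (0 : ℝ) t).isPathConnected ⟨0, le_rfl, ht⟩).image τ.continuous_extend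
  have h0 : a ∈ τ.extend '' Set.Icc 0 t := ⟨0, ⟨le_rfl, ht⟩, τ.extend_zero⟩
  exact h.joinedIn a h0 _ ⟨t, ⟨ht, le_rfl⟩, rfl⟩

section
variable {E : Type*} [TopologicalSpace E] {D : E → E → ℝ} {R ε : ℝ}

/-- Follow a path from `y` until it first comes within `R` of one of the two centers, then go almost
straight to that center; the other ball is too far to be met. Equivalently, the part cut off from
`q'` by the ball around `q` and the part cut off from `q` by the ball around `q'` are disjoint. -/
theorem IsLengthDist.joinedIn_or_of_le_dist [PathConnectedSpace E] (hD : IsLengthDist D)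
    (hR : 0 ≤ R) (hε : 0 < ε) {q q' : E} (hq : 2 * R + ε ≤ D q q') (y : E) :
    JoinedIn {x | D q x < R}ᶜ q' y ∨ JoinedIn {x | D q' x < R}ᶜ q y := by
  let τ := PathConnectedSpace.somePath y q
  have key : ∀ q q' : E, 2 * R + ε ≤ D q q' → ∀ t : ℝ, 0 ≤ t → D q (τ.extend t) ≤ R →
      (∀ s, 0 ≤ s → s < t → R < D q' (τ.extend s)) → JoinedIn {x | D q' x < R}ᶜ q y := by
    intro q q' hq t ht hle hlt
    have h1 : JoinedIn {x | D q' x < R}ᶜ y (τ.extend t) := by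
      refine (τ.joinedIn_image_Icc ht).mono ?_
      rintro _ ⟨s, ⟨hs0, hst⟩, rfl⟩ hs
      have hs' : D q' (τ.extend s) < R := hs
      rcases hst.lt_or_eq with h | rfl
      · linarith [hlt s hs0 h]
      · have := hD.triangle q (τ.extend s) q'
        rw [hD.symm (τ.extend s) q'] at this
        linarith
    obtain ⟨α, hα⟩ := hD.exists_path (show D q (τ.extend t) < R + ε by linarith)
    have h2 : JoinedIn {x | D q' x < R}ᶜ q (τ.extend t) := by
      refine ⟨α, fun s hs => ?_⟩
      have hs' : D q' (α s) < R := hs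
      have h3 := hα s
      have h4 := hD.nonneg (α s) (τ.extend t)
      have h5 := hD.triangle q (α s) q'
      rw [hD.symm (α s) q'] at h5
      linarith
    exact h2.trans h1.symm
  have hcont : Continuous fun t : ℝ => min (D q (τ.extend t)) (D q' (τ.extend t)) :=
    ((hD.continuous q).comp τ.continuous_extend).min ((hD.continuous q').comp τ.continuous_extend)
  have hcomp : IsCompact (Set.Icc (0 : ℝ) 1 ∩
      {t | min (D q (τ.extend t)) (D q' (τ.extend t)) ≤ R}) :=
    isCompact_Icc.inter_right (isClosed_le hcont continuous_const)
  have hend : min (D q (τ.extend 1)) (D q' (τ.extend 1)) ≤ R :=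
    (min_le_left _ _).trans (by rw [τ.extend_one, hD.self]; exact hR)
  obtain ⟨t, ⟨ht, hmin⟩, hleast⟩ := hcomp.exists_isLeast ⟨1, ⟨zero_le_one, le_rfl⟩, hend⟩
  have hbefore : ∀ s, 0 ≤ s → s < t → R < D q (τ.extend s) ∧ R < D q' (τ.extend s) := by
    intro s hs hst
    by_contra hcon
    have : min (D q (τ.extend s)) (D q' (τ.extend s)) ≤ R := by
      rw [← lt_min_iff, not_lt] at hcon
      exact hcon
    exact absurd (hleast ⟨⟨hs, hst.le.trans ht.2⟩, this⟩) (not_le.2 hst)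
  rcases min_le_iff.1 (show min (D q (τ.extend t)) (D q' (τ.extend t)) ≤ R from hmin) with h | h
  · exact Or.inr (key q q' hq t ht.1 h fun s hs hst => (hbefore s hs hst).2)
  · exact Or.inl (key q' q (by rwa [hD.symm]) t ht.1 h fun s hs hst => (hbefore s hs hst).1)

theorem joinedIn_smul_ball {G : Type*} [Group G] [MulAction G E] [ContinuousConstSMul G E]
    (hG : ∀ (g : G) a b, D (g • a) (g • b) = D a b) (g : G) {c x y : E}
    (h : JoinedIn {z | D c z < R}ᶜ x y) : JoinedIn {z | D (g • c) z < R}ᶜ (g • x) (g • y) := by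
  obtain ⟨γ, hγ⟩ := h
  refine ⟨γ.map (continuous_const_smul g), fun t ht => hγ t ?_⟩
  have ht' : D (g • c) (g • γ t) < R := ht
  rwa [hG] at ht'

theorem smul_preimage_not_joinedIn {G : Type*} [Group G] [MulAction G E] [ContinuousConstSMul G E]
    (hG : ∀ (g : G) a b, D (g • a) (g • b) = D a b) (g : G) (c x : E) :
    {y | ¬ JoinedIn {z | D (g • c) z < R}ᶜ x y} =
      (fun y => g⁻¹ • y) ⁻¹' {y | ¬ JoinedIn {z | D c z < R}ᶜ (g⁻¹ • x) y} := by
  ext y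
  refine not_congr ⟨fun h => ?_, fun h => ?_⟩
  · simpa using joinedIn_smul_ball hG g⁻¹ h
  · simpa using joinedIn_smul_ball hG g h

/-- If the complement of every component of the complement of a ball is big, and there are no three
disjoint big sets, then among three far apart translates of the ball one separates the others. -/
theorem IsLengthDist.separates_of_big [PathConnectedSpace E] (hD : IsLengthDist D)
    {G : Type*} [Group G] [MulAction G E] [ContinuousConstSMul G E]
    (hG : ∀ (g : G) a b, D (g • a) (g • b) = D a b) (hR : 0 ≤ R) (hε : 0 < ε)
    {Big : Set E → Prop} (hinv : ∀ (g : G) S, Big S → Big ((fun y => g • y) ⁻¹' S)) {c : E}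
    (hbig : ∀ x, Big {y | ¬ JoinedIn {z | D c z < R}ᶜ x y})
    (hthree : ∀ q x : Fin 3 → E, (∀ i, Big {y | ¬ JoinedIn {z | D (q i) z < R}ᶜ (x i) y}) →
      ∃ i j y, i ≠ j ∧ ¬ JoinedIn {z | D (q i) z < R}ᶜ (x i) y ∧
        ¬ JoinedIn {z | D (q j) z < R}ᶜ (x j) y)
    {q₁ q₂ q₃ : E} (hq₁ : q₁ ∈ MulAction.orbit G c) (hq₂ : q₂ ∈ MulAction.orbit G c)
    (hq₃ : q₃ ∈ MulAction.orbit G c) (h12 : 2 * R + ε ≤ D q₁ q₂) (h13 : 2 * R + ε ≤ D q₁ q₃)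
    (h23 : 2 * R + ε ≤ D q₂ q₃) :
    (∀ γ : Path q₂ q₃, ∃ t, D q₁ (γ t) < R) ∨ (∀ γ : Path q₁ q₃, ∃ t, D q₂ (γ t) < R) ∨
      ∀ γ : Path q₁ q₂, ∃ t, D q₃ (γ t) < R := by
  by_contra! hcon
  obtain ⟨⟨γ₁, h1⟩, ⟨γ₂, h2⟩, γ₃, h3⟩ := hcon
  have j1 : JoinedIn {z | D q₁ z < R}ᶜ q₂ q₃ := ⟨γ₁, fun t => not_lt.2 (h1 t)⟩
  have j2 : JoinedIn {z | D q₂ z < R}ᶜ q₁ q₃ := ⟨γ₂, fun t => not_lt.2 (h2 t)⟩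
  have j3 : JoinedIn {z | D q₃ z < R}ᶜ q₁ q₂ := ⟨γ₃, fun t => not_lt.2 (h3 t)⟩
  have hall : ∀ q ∈ MulAction.orbit G c, ∀ x, Big {y | ¬ JoinedIn {z | D q z < R}ᶜ x y} := by
    rintro _ ⟨g, rfl⟩ x
    change Big {y | ¬ JoinedIn {z | D (g • c) z < R}ᶜ x y}
    rw [smul_preimage_not_joinedIn hG]
    exact hinv _ _ (hbig _)
  have h12' : ∀ y, JoinedIn {z | D q₁ z < R}ᶜ q₂ y ∨ JoinedIn {z | D q₂ z < R}ᶜ q₁ y :=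
    hD.joinedIn_or_of_le_dist hR hε h12
  have h13' : ∀ y, JoinedIn {z | D q₁ z < R}ᶜ q₂ y ∨ JoinedIn {z | D q₃ z < R}ᶜ q₁ y := fun y =>
    (hD.joinedIn_or_of_le_dist hR hε h13 y).imp j1.trans id
  have h23' : ∀ y, JoinedIn {z | D q₂ z < R}ᶜ q₁ y ∨ JoinedIn {z | D q₃ z < R}ᶜ q₁ y := fun y =>
    (hD.joinedIn_or_of_le_dist hR hε h23 y).imp j2.trans j3.trans
  -- If no ball separates, each base point in `![q₂, q₁, q₁]` represents the component holding both
  -- other centers, and the complements of these three components are pairwise disjoint.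
  obtain ⟨i, j, y, hij, hi, hj⟩ := hthree ![q₁, q₂, q₃] ![q₂, q₁, q₁] (by
    intro i
    fin_cases i
    exacts [hall q₁ hq₁ q₂, hall q₂ hq₂ q₁, hall q₃ hq₃ q₁])
  fin_cases i <;> fin_cases j <;> simp at hij hi hj <;>
    first
    | exact absurd (h12' y) (not_or.2 ⟨hi, hj⟩)
    | exact absurd (h12' y) (not_or.2 ⟨hj, hi⟩)
    | exact absurd (h13' y) (not_or.2 ⟨hi, hj⟩)
    | exact absurd (h13' y) (not_or.2 ⟨hj, hi⟩)
    | exact absurd (h23' y) (not_or.2 ⟨hi, hj⟩)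
    | exact absurd (h23' y) (not_or.2 ⟨hj, hi⟩)
end

/-! ### The two tails of a cyclic orbit -/

section
variable {E : Type*} [TopologicalSpace E] {D : E → E → ℝ} {G : Type*} [Group G] [MulAction G E]
  [ContinuousConstSMul G E] {e : E} {a : G}

/-- A fixed path from `e` to `g • e`, translated by a high power of `a`, is far from the ball. It
serves with `g = a` to connect a tail, and with coset representatives to bring any orbit point to a
tail. -/
theorem IsLengthDist.exists_forall_joinedIn_zpow_smul (hD : IsLengthDist D)
    (hG : ∀ (g : G) a b, D (g • a) (g • b) = D a b)
    (hprop : ∀ B, ∃ N : ℕ, ∀ m : ℤ, N ≤ m.natAbs → B < D e (a ^ m • e)) (c : E) (R : ℝ) (g : G) :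
    ∃ N : ℕ, ∀ m : ℤ, N ≤ m.natAbs →
      JoinedIn {z | D c z < R}ᶜ (a ^ m • e) (a ^ m • g • e) := by
  obtain ⟨σ, hσ⟩ := hD.exists_path (lt_add_one (D e (g • e)))
  obtain ⟨N, hN⟩ := hprop (R + D c e + (D e (g • e) + 1))
  refine ⟨N, fun m hm => ⟨σ.map (continuous_const_smul (a ^ m)), fun t ht => ?_⟩⟩
  have ht' : D c (a ^ m • σ t) < R := ht
  have h1 := hN m hm
  have h2 := hσ t
  have h3 := hD.nonneg (σ t) (g • e)
  have h4 := hD.triangle e c (a ^ m • e)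
  have h5 := hD.triangle c (a ^ m • σ t) (a ^ m • e)
  rw [hG, hD.symm (σ t) e] at h5
  rw [hD.symm e c] at h4
  linarith

theorem IsLengthDist.exists_tails (hD : IsLengthDist D)
    (hG : ∀ (g : G) a b, D (g • a) (g • b) = D a b)
    (hprop : ∀ B, ∃ N : ℕ, ∀ m : ℤ, N ≤ m.natAbs → B < D e (a ^ m • e)) (c : E) (R : ℝ) :
    ∃ N : ℕ, (∀ m n : ℤ, N ≤ m → N ≤ n → JoinedIn {z | D c z < R}ᶜ (a ^ m • e) (a ^ n • e)) ∧
      ∀ m n : ℤ, m ≤ -N → n ≤ -N → JoinedIn {z | D c z < R}ᶜ (a ^ m • e) (a ^ n • e) := by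
  obtain ⟨N, hN⟩ := hD.exists_forall_joinedIn_zpow_smul hG hprop c R a
  have hstep : ∀ m : ℤ, N ≤ m.natAbs →
      JoinedIn {z | D c z < R}ᶜ (a ^ m • e) (a ^ (m + 1) • e) := by
    intro m hm
    rw [zpow_add_one, mul_smul]
    exact hN m hm
  have hpos : ∀ k : ℕ, JoinedIn {z | D c z < R}ᶜ (a ^ ((N : ℤ) + 1) • e)
      (a ^ ((N : ℤ) + 1 + k) • e) := by
    intro k
    induction k with
    | zero => simpa using JoinedIn.refl (hstep (N + 1) (by omega)).source_mem
    | succ k ih =>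
      refine ih.trans ?_
      rw [Nat.cast_succ, ← add_assoc]
      exact hstep ((N : ℤ) + 1 + k) (by omega)
  have hneg : ∀ k : ℕ, JoinedIn {z | D c z < R}ᶜ (a ^ (-((N : ℤ) + 1)) • e)
      (a ^ (-((N : ℤ) + 1) - k) • e) := by
    intro k
    induction k with
    | zero => simpa using JoinedIn.refl (hstep (-((N : ℤ) + 1)) (by omega)).source_mem
    | succ k ih =>
      refine ih.trans ?_
      have := hstep (-((N : ℤ) + 1) - (k + 1 : ℕ)) (by omega)
      rw [show -((N : ℤ) + 1) - (k + 1 : ℕ) + 1 = -((N : ℤ) + 1) - k by push_cast; ring] at this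
      exact this.symm
  refine ⟨N + 1, fun m n hm hn => ?_, fun m n hm hn => ?_⟩
  · obtain ⟨k, hk⟩ := Int.eq_ofNat_of_zero_le (show 0 ≤ m - (N + 1) by push_cast at hm; omega)
    obtain ⟨l, hl⟩ := Int.eq_ofNat_of_zero_le (show 0 ≤ n - (N + 1) by push_cast at hn; omega)
    rw [show m = N + 1 + k by omega, show n = N + 1 + l by omega]
    exact (hpos k).symm.trans (hpos l)
  · obtain ⟨k, hk⟩ := Int.eq_ofNat_of_zero_le (show 0 ≤ -(N + 1) - m by push_cast at hm; omega)
    obtain ⟨l, hl⟩ := Int.eq_ofNat_of_zero_le (show 0 ≤ -(N + 1) - n by push_cast at hn; omega)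
    rw [show m = -(N + 1) - k by omega, show n = -(N + 1) - l by omega]
    exact (hneg k).symm.trans (hneg l)

end

/-! ### Choice of the center -/

section
variable {E : Type*} [TopologicalSpace E] [SimplyConnectedSpace E] [LocallyPathConnectedSpace E]
  {D : E → E → ℝ} {R w ε : ℝ} {W : Type*} {L : AbstractSimplicialComplex W}
  {f : E → Realization L} {G : Type*} [Group G] [MulAction G E] [ContinuousConstSMul G E]

/-- The center lies on a median fiber of one full orbit, and the ball contains this fiber. Big means
containing at least half of the orbit, counted by group elements; three disjoint such sets cannot
exist. -/
theorem IsLengthDist.exists_separating_center_of_finite (hD : IsLengthDist D)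
    (hG : ∀ (g : G) a b, D (g • a) (g • b) = D a b) (hL : ∀ s ∈ L, s.card ≤ 2) (hf : Continuous f)
    (hw : ∀ x y, f x = f y → D x y ≤ w) (hw0 : 0 ≤ w) (hwR : w < R) (hε : 0 < ε) [Finite G] :
    ∃ c : E, ∀ q₁ ∈ MulAction.orbit G c, ∀ q₂ ∈ MulAction.orbit G c, ∀ q₃ ∈ MulAction.orbit G c,
      2 * R + ε ≤ D q₁ q₂ → 2 * R + ε ≤ D q₁ q₃ → 2 * R + ε ≤ D q₂ q₃ →
      (∀ γ : Path q₂ q₃, ∃ t, D q₁ (γ t) < R) ∨ (∀ γ : Path q₁ q₃, ∃ t, D q₂ (γ t) < R) ∨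
        ∀ γ : Path q₁ q₂, ∃ t, D q₃ (γ t) < R := by
  classical
  have := Fintype.ofFinite G
  obtain ⟨e⟩ : Nonempty E := inferInstance
  have hn : 0 < Fintype.card G := Fintype.card_pos
  obtain ⟨y, hy⟩ := exists_median_fiber hL hf (fun g : G => g • e)
  obtain ⟨c, hc⟩ : ∃ c, f c = y := by
    by_contra! hcon
    have := hy Finset.univ (fun k _ l _ => ⟨PathConnectedSpace.somePath _ _, fun t => hcon _⟩)
    rw [Finset.card_univ] at this
    omega
  have hball : {z | D c z < R}ᶜ ⊆ (f ⁻¹' {y})ᶜ := by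
    refine Set.compl_subset_compl.2 fun z hz => ?_
    exact (hw c z (hc.trans (show f z = y from hz).symm)).trans_lt hwR
  refine ⟨c, fun q₁ hq₁ q₂ hq₂ q₃ hq₃ h12 h13 h23 => hD.separates_of_big (G := G) hG
    (hw0.trans hwR.le) hε (Big := fun S => Fintype.card G ≤
      2 * (Finset.univ.filter fun g : G => g • e ∈ S).card) ?_ (c := c) ?_ ?_ hq₁ hq₂ hq₃ h12 h13
      h23⟩
  · intro g S hS
    refine hS.trans (Nat.mul_le_mul_left _ ?_)
    refine Finset.card_le_card_of_injOn (fun k => g⁻¹ * k) (fun k hk => ?_)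
      (mul_right_injective g⁻¹).injOn
    simp only [Finset.coe_filter, Finset.mem_univ, true_and, Set.mem_ofPred_eq,
      Set.mem_preimage] at hk ⊢
    rwa [← mul_smul, mul_inv_cancel_left]
  · intro x
    have h1 := hy (Finset.univ.filter fun g : G => JoinedIn {z | D c z < R}ᶜ x (g • e)) (by
      intro k hk l hl
      simp only [Finset.mem_filter, Finset.mem_univ, true_and] at hk hl
      exact (hk.symm.trans hl).mono hball)
    have h2 := Finset.card_filter_add_card_filter_not (s := (Finset.univ : Finset G))
      (fun g : G => JoinedIn {z | D c z < R}ᶜ x (g • e))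
    rw [Finset.card_univ] at h2
    simp only [Set.mem_ofPred_eq]
    omega
  · intro q x hbig
    by_contra! hcon
    let S : Fin 3 → Finset G := fun i =>
      Finset.univ.filter fun g : G => ¬ JoinedIn {z | D (q i) z < R}ᶜ (x i) (g • e)
    have hS : ∀ i, Fintype.card G ≤ 2 * (S i).card := by
      intro i
      have := hbig i
      simp only [Set.mem_ofPred_eq] at this
      exact this
    have hd : ∀ i j, i ≠ j → Disjoint (S i) (S j) := by
      intro i j hij
      refine Finset.disjoint_left.2 fun g hi hj => ?_
      simp only [S, Finset.mem_filter, Finset.mem_univ, true_and] at hi hj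
      exact hj (hcon i j (g • e) hij hi)
    have h01 := Finset.card_union_of_disjoint (hd 0 1 (by decide))
    have h012 := Finset.card_union_of_disjoint (Finset.disjoint_union_left.2
      ⟨hd 0 2 (by decide), hd 1 2 (by decide)⟩)
    have hle := Finset.card_le_univ (S 0 ∪ S 1 ∪ S 2)
    have := hS 0
    have := hS 1
    have := hS 2
    omega

variable {e : E} {a : G}

/-- A point such that a slightly larger ball around it separates the two ends. -/
theorem IsLengthDist.exists_center_separating_ends (hD : IsLengthDist D)
    (hG : ∀ (g : G) a b, D (g • a) (g • b) = D a b) (hL : ∀ s ∈ L, s.card ≤ 2) (hf : Continuous f)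
    (hw : ∀ x y, f x = f y → D x y ≤ w) (hwR : w < R)
    (hprop : ∀ B, ∃ N : ℕ, ∀ m : ℤ, N ≤ m.natAbs → B < D e (a ^ m • e)) :
    ∃ c : E, ∀ N : ℕ, ∃ m : ℕ, N ≤ m ∧
      ¬ JoinedIn {z | D c z < R}ᶜ (a ^ (-(m : ℤ)) • e) (a ^ (m : ℤ) • e) := by
  obtain ⟨σ, hσ⟩ := hD.exists_path (lt_add_one (D e (a • e)))
  have hσ' : ∀ t, D e (σ t) ≤ D e (a • e) + 1 := fun t => by
    linarith [hσ t, hD.nonneg (σ t) (a • e)]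
  let τ : ℤ → Set E := fun j => (fun x => a ^ j • x) '' Set.range σ
  have hτ : ∀ j : ℤ, JoinedIn (τ j) (a ^ j • e) (a ^ (j + 1) • e) := by
    intro j
    rw [zpow_add_one, mul_smul]
    exact ⟨σ.map (continuous_const_smul (a ^ j)), fun t => ⟨σ t, ⟨t, rfl⟩, rfl⟩⟩
  have hpos : ∀ n : ℕ, JoinedIn (⋃ j : ℕ, τ j) e (a ^ (n : ℤ) • e) := by
    intro n
    induction n with
    | zero =>
      have := (hτ 0).source_mem
      simp only [zpow_zero, one_smul] at this
      simpa using JoinedIn.refl (Set.mem_iUnion.2 ⟨0, by simpa using this⟩)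
    | succ n ih =>
      refine ih.trans ?_
      push_cast
      exact (hτ n).mono (Set.subset_iUnion (fun j : ℕ => τ j) n)
  have hneg : ∀ n : ℕ, JoinedIn (⋃ j : ℕ, τ (-(j : ℤ) - 1)) (a ^ (-(n : ℤ)) • e) e := by
    intro n
    induction n with
    | zero =>
      have := (hτ (-1)).target_mem
      simp only [neg_add_cancel, zpow_zero, one_smul] at this
      simpa using JoinedIn.refl (Set.mem_iUnion.2
        (⟨0, by simpa using this⟩ : ∃ j : ℕ, e ∈ τ (-(j : ℤ) - 1)))
    | succ n ih =>
      refine JoinedIn.trans ?_ ih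
      have := (hτ (-(n : ℤ) - 1)).mono (Set.subset_iUnion (fun j : ℕ => τ (-(j : ℤ) - 1)) n)
      rw [sub_add_cancel] at this
      rwa [show -((n + 1 : ℕ) : ℤ) = -(n : ℤ) - 1 by push_cast; ring]
  obtain ⟨N₀, hN₀⟩ := hprop (w + 2 * (D e (a • e) + 1))
  -- A median fiber of `a ^ (-n) • e`, `e`, `a ^ n • e` meets both half-orbit paths. Its diameter is
  -- at most `w`, so by properness the two meeting points have bounded indices, uniformly in `n`.
  have hmed : ∀ n : ℕ, ∃ u, (∃ j : ℕ, j < N₀ ∧ u ∈ τ j) ∧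
      ∀ γ : Path (a ^ (-(n : ℤ)) • e) (a ^ (n : ℤ) • e), ∃ t, f (γ t) = f u := by
    intro n
    obtain ⟨y, hy1, hy2, hy3⟩ := exists_fiber_meeting_paths hL hf (a ^ (-(n : ℤ)) • e) e
      (a ^ (n : ℤ) • e)
    obtain ⟨γ₁, hγ₁⟩ := hneg n
    obtain ⟨γ₂, hγ₂⟩ := hpos n
    obtain ⟨t₁, ht₁⟩ := hy1 γ₁
    obtain ⟨t₂, ht₂⟩ := hy2 γ₂
    obtain ⟨i, _, ⟨s₁, rfl⟩, hi⟩ := Set.mem_iUnion.1 (hγ₁ t₁)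
    obtain ⟨j, _, ⟨s₂, rfl⟩, hj⟩ := Set.mem_iUnion.1 (hγ₂ t₂)
    refine ⟨γ₂ t₂, ⟨j, ?_, σ s₂, ⟨s₂, rfl⟩, hj⟩, fun γ => by rw [ht₂]; exact hy3 γ⟩
    by_contra hcon
    have hbig := hN₀ ((i : ℤ) + 1 + j) (by omega)
    have h1 := hw _ _ (ht₁.trans ht₂.symm)
    simp only at hi hj
    rw [← hi, ← hj] at h1
    have h2 := hD.triangle (a ^ (-(i : ℤ) - 1) • e) (a ^ (-(i : ℤ) - 1) • σ s₁) (a ^ (j : ℤ) • e)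
    have h3 := hD.triangle (a ^ (-(i : ℤ) - 1) • σ s₁) (a ^ (j : ℤ) • σ s₂) (a ^ (j : ℤ) • e)
    rw [hG] at h2
    rw [hG (a ^ (j : ℤ)), hD.symm (σ s₂) e] at h3
    have h4 := hσ' s₁
    have h5 := hσ' s₂
    have h6 : D e (a ^ ((i : ℤ) + 1 + j) • e) =
        D (a ^ (-(i : ℤ) - 1) • e) (a ^ (j : ℤ) • e) := by
      rw [← hG (a ^ (-(i : ℤ) - 1)) e, ← mul_smul, ← zpow_add]
      congr 3
      ring
    linarith
  choose u hu hmeet using hmed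
  have hcomp : IsCompact (⋃ j ∈ Set.Iio N₀, τ ((j : ℕ) : ℤ)) :=
    (Set.finite_Iio N₀).isCompact_biUnion fun j _ =>
      (isCompact_range σ.continuous).image (continuous_const_smul _)
  obtain ⟨c, -, hc⟩ := hcomp.exists_mapClusterPt (f := Filter.atTop) (u := u) (by
    refine Filter.tendsto_principal.2 (Filter.Eventually.of_forall fun n => ?_)
    obtain ⟨j, hj, hjn⟩ := hu n
    exact Set.mem_biUnion hj hjn)
  refine ⟨c, fun N => ?_⟩
  -- The slack `R - w` absorbs the passage from `u m` to the cluster point `c`: the ball around `c`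
  -- contains the whole fiber through `u m` for infinitely many `m`.
  have hnhds : {z | D c z < R - w} ∈ nhds c :=
    (hD.isOpen_ball c _).mem_nhds (by
      change D c c < R - w
      rw [hD.self]; linarith)
  have hfreq := hc.frequently hnhds
  obtain ⟨m, hm, hcm⟩ :=
    (hfreq.and_eventually (Filter.eventually_ge_atTop N)).exists.imp fun _ h => h.symm
  refine ⟨m, hm, fun ⟨γ, hγ⟩ => ?_⟩
  obtain ⟨t, ht⟩ := hmeet m γ
  refine hγ t ?_
  have h1 := hw _ _ ht.symm
  have h2 := hD.triangle c (u m) (γ t)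
  have h3 : D c (u m) < R - w := hcm
  change D c (γ t) < R
  linarith

/-- Here big means containing infinitely many orbit elements. A big complement of a component
contains a whole tail of the orbit, and there are only two tails, so among three such sets two
intersect. -/
theorem IsLengthDist.exists_separating_center_of_infinite (hD : IsLengthDist D)
    (hG : ∀ (g : G) a b, D (g • a) (g • b) = D a b) (hL : ∀ s ∈ L, s.card ≤ 2) (hf : Continuous f)
    (hw : ∀ x y, f x = f y → D x y ≤ w) (hw0 : 0 ≤ w) (hwR : w < R) (hε : 0 < ε)
    (hprop : ∀ B, ∃ N : ℕ, ∀ m : ℤ, N ≤ m.natAbs → B < D e (a ^ m • e))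
    {K : Finset G} (hK : ∀ g, ∃ n : ℤ, ∃ k ∈ K, g = a ^ n * k) :
    ∃ c : E, ∀ q₁ ∈ MulAction.orbit G c, ∀ q₂ ∈ MulAction.orbit G c, ∀ q₃ ∈ MulAction.orbit G c,
      2 * R + ε ≤ D q₁ q₂ → 2 * R + ε ≤ D q₁ q₃ → 2 * R + ε ≤ D q₂ q₃ →
      (∀ γ : Path q₂ q₃, ∃ t, D q₁ (γ t) < R) ∨ (∀ γ : Path q₁ q₃, ∃ t, D q₂ (γ t) < R) ∨
        ∀ γ : Path q₁ q₂, ∃ t, D q₃ (γ t) < R := by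
  classical
  obtain ⟨c, hc⟩ := hD.exists_center_separating_ends hG hL hf hw hwR hprop
  have hinj : Function.Injective fun m : ℤ => a ^ m := by
    refine injective_zpow_iff_not_isOfFinOrder.2 fun hfin => ?_
    obtain ⟨n, hn, hone⟩ := isOfFinOrder_iff_pow_eq_one.1 hfin
    obtain ⟨N, hN⟩ := hprop 0
    have h1 := hN ((n : ℤ) * N) (by
      rw [Int.natAbs_mul]
      exact Nat.le_mul_of_pos_left N (by simpa using hn))
    rw [zpow_mul, zpow_natCast, zpow_natCast, hone, one_pow, one_smul, hD.self] at h1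
    exact lt_irrefl _ h1
  refine ⟨c, fun q₁ hq₁ q₂ hq₂ q₃ hq₃ h12 h13 h23 => hD.separates_of_big (G := G) hG
    (hw0.trans hwR.le) hε (Big := fun S => {g : G | g • e ∈ S}.Infinite) ?_ (c := c) ?_ ?_ hq₁ hq₂
      hq₃ h12 h13 h23⟩
  · intro g S hS
    have : {k : G | k • e ∈ (fun y => g • y) ⁻¹' S} = (fun k => g * k) ⁻¹' {k | k • e ∈ S} := by
      ext k
      change g • k • e ∈ S ↔ (g * k) • e ∈ S
      rw [mul_smul]
    rw [this]
    exact hS.preimage fun k _ => ⟨g⁻¹ * k, mul_inv_cancel_left g k⟩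
  · intro x
    obtain ⟨N, hpos, hneg⟩ := hD.exists_tails hG hprop c R
    obtain ⟨m, hm, hmc⟩ := hc N
    -- The ball separates the ends, so the component of `x` misses at least one of the two tails.
    by_cases hx : JoinedIn {z | D c z < R}ᶜ x (a ^ (m : ℤ) • e)
    · refine Set.infinite_of_injective_forall_mem (f := fun n : ℕ => a ^ (-(n : ℤ) - N))
        (fun i j hij => ?_) fun n => ?_
      · have := hinj hij
        omega
      · intro hcon
        refine hmc (JoinedIn.trans ?_ hx)
        exact (hneg _ _ (by omega) (by omega)).trans hcon.symm
    · refine Set.infinite_of_injective_forall_mem (f := fun n : ℕ => a ^ ((n : ℤ) + N))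
        (fun i j hij => ?_) fun n => ?_
      · have := hinj hij
        omega
      · intro hcon
        exact hx (hcon.trans (hpos _ _ (by omega) (by omega)))
  · intro q x hbig
    have hend : ∀ i, ∃ N : ℕ,
        (∀ m : ℤ, N ≤ m → ¬ JoinedIn {z | D (q i) z < R}ᶜ (x i) (a ^ m • e)) ∨
        ∀ m : ℤ, m ≤ -N → ¬ JoinedIn {z | D (q i) z < R}ᶜ (x i) (a ^ m • e) := by
      intro i
      obtain ⟨N, hpos, hneg⟩ := hD.exists_tails hG hprop (q i) R
      choose M hM using hD.exists_forall_joinedIn_zpow_smul hG hprop (q i) R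
      -- Beyond this bound, every `a ^ m * k` with `k ∈ K` is joined to `a ^ m` off the ball, and `a
      -- ^ m` lies in a connected tail. Only finitely many group elements are excluded.
      let N' := N + ∑ k ∈ K, M k
      have hfin : (Set.image2 (fun (m : ℤ) (k : G) => a ^ m * k) (Set.Icc (-(N' : ℤ)) N')
          K).Finite := (Set.finite_Icc _ _).image2 _ K.finite_toSet
      obtain ⟨g, hg, hgn⟩ := (hbig i).exists_notMem_finite hfin
      obtain ⟨m, k, hk, rfl⟩ := hK g
      have hm : N' < m.natAbs := by
        by_contra hle
        exact hgn ⟨m, ⟨by omega, by omega⟩, k, hk, rfl⟩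
      have hMk : M k ≤ ∑ k ∈ K, M k := Finset.single_le_sum (fun _ _ => Nat.zero_le _) hk
      have hNm : N < m.natAbs := lt_of_le_of_lt (Nat.le_add_right _ _) hm
      have hMm : M k ≤ m.natAbs := by omega
      have hj := hM k m hMm
      rw [← mul_smul] at hj
      have hg' : ¬ JoinedIn {z | D (q i) z < R}ᶜ (x i) ((a ^ m * k) • e) := hg
      refine ⟨N, ?_⟩
      rcases le_total 0 m with h0 | h0
      · exact Or.inl fun n hn hcon => hg' ((hcon.trans (hpos _ _ hn (by omega))).trans hj)
      · exact Or.inr fun n hn hcon => hg' ((hcon.trans (hneg _ _ hn (by omega))).trans hj)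
    choose N hN using hend
    have htwo : ∃ i j, i ≠ j ∧
        ((∀ m : ℤ, N i ≤ m → ¬ JoinedIn {z | D (q i) z < R}ᶜ (x i) (a ^ m • e)) ∧
          (∀ m : ℤ, N j ≤ m → ¬ JoinedIn {z | D (q j) z < R}ᶜ (x j) (a ^ m • e)) ∨
        (∀ m : ℤ, m ≤ -N i → ¬ JoinedIn {z | D (q i) z < R}ᶜ (x i) (a ^ m • e)) ∧
          ∀ m : ℤ, m ≤ -N j → ¬ JoinedIn {z | D (q j) z < R}ᶜ (x j) (a ^ m • e)) := by
      rcases hN 0 with h0 | h0 <;> rcases hN 1 with h1 | h1 <;> rcases hN 2 with h2 | h2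
      · exact ⟨0, 1, by decide, Or.inl ⟨h0, h1⟩⟩
      · exact ⟨0, 1, by decide, Or.inl ⟨h0, h1⟩⟩
      · exact ⟨0, 2, by decide, Or.inl ⟨h0, h2⟩⟩
      · exact ⟨1, 2, by decide, Or.inr ⟨h1, h2⟩⟩
      · exact ⟨1, 2, by decide, Or.inl ⟨h1, h2⟩⟩
      · exact ⟨0, 2, by decide, Or.inr ⟨h0, h2⟩⟩
      · exact ⟨0, 1, by decide, Or.inr ⟨h0, h1⟩⟩
      · exact ⟨0, 1, by decide, Or.inr ⟨h0, h1⟩⟩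
    obtain ⟨i, j, hij, ⟨hi, hj⟩ | ⟨hi, hj⟩⟩ := htwo
    · exact ⟨i, j, a ^ ((N i : ℤ) + N j) • e, hij, hi _ (by omega), hj _ (by omega)⟩
    · exact ⟨i, j, a ^ (-(N i : ℤ) - N j) • e, hij, hi _ (by omega), hj _ (by omega)⟩
end

/-! ### Riemannian lengths on a single simplex -/

section Simplex
variable {V : Type*}

theorem convex_closedSimplex (s : Finset V) : Convex ℝ (closedSimplex s) := by
  intro x hx y hy a b ha hb hab
  refine ⟨fun v => ?_, fun v hv => ?_, ?_⟩
  · exact add_nonneg (mul_nonneg ha (hx.1 v)) (mul_nonneg hb (hy.1 v))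
  · simp [hx.2.1 v hv, hy.2.1 v hv]
  · simp only [Pi.add_apply, Pi.smul_apply, smul_eq_mul, Finset.sum_add_distrib,
      ← Finset.mul_sum, hx.2.2, hy.2.2]
    linarith

theorem isClosed_closedSimplex (s : Finset V) : IsClosed (closedSimplex s) := by
  have h1 : IsClosed {x : V → ℝ | ∀ v, 0 ≤ x v} := by
    simp only [Set.ofPred_forall]
    exact isClosed_iInter fun v => isClosed_le continuous_const (continuous_apply v)
  have h2 : IsClosed {x : V → ℝ | ∀ v, v ∉ s → x v = 0} := by
    simp only [Set.ofPred_forall]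
    exact isClosed_iInter fun v => isClosed_iInter fun _ =>
      isClosed_eq (continuous_apply v) continuous_const
  have h3 : IsClosed {x : V → ℝ | ∑ v ∈ s, x v = 1} :=
    isClosed_eq (continuous_finsetSum _ fun v _ => continuous_apply v) continuous_const
  exact h1.inter (h2.inter h3)

theorem isCompact_closedSimplex [Fintype V] (s : Finset V) : IsCompact (closedSimplex s) := by
  refine Metric.isCompact_of_isClosed_isBounded (isClosed_closedSimplex s) ?_
  refine (Metric.isBounded_closedBall (x := (0 : V → ℝ)) (r := 1)).subset fun x hx => ?_
  rw [mem_closedBall_zero_iff, pi_norm_le_iff_of_nonneg zero_le_one]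
  intro v
  rw [Real.norm_of_nonneg (hx.1 v)]
  by_cases hv : v ∈ s
  · rw [← hx.2.2]
    exact Finset.single_le_sum (fun i _ => hx.1 i) hv
  · rw [hx.2.1 v hv]
    exact zero_le_one

theorem isClosed_simplexTangent (s : Finset V) : IsClosed (simplexTangent s) := by
  have h2 : IsClosed {x : V → ℝ | ∀ v, v ∉ s → x v = 0} := by
    simp only [Set.ofPred_forall]
    exact isClosed_iInter fun v => isClosed_iInter fun _ =>
      isClosed_eq (continuous_apply v) continuous_const
  have h3 : IsClosed {x : V → ℝ | ∑ v ∈ s, x v = 0} :=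
    isClosed_eq (continuous_finsetSum _ fun v _ => continuous_apply v) continuous_const
  exact h2.inter h3

theorem sub_mem_simplexTangent {s : Finset V} {x y : V → ℝ} (hx : x ∈ closedSimplex s)
    (hy : y ∈ closedSimplex s) : y - x ∈ simplexTangent s := by
  refine ⟨fun v hv => ?_, ?_⟩
  · simp [hx.2.1 v hv, hy.2.1 v hv]
  · simp [Finset.sum_sub_distrib, hx.2.2, hy.2.2]

theorem smul_mem_simplexTangent {s : Finset V} {v : V → ℝ} (hv : v ∈ simplexTangent s) (r : ℝ) :
    r • v ∈ simplexTangent s := by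
  refine ⟨fun i hi => ?_, ?_⟩
  · simp [hv.1 i hi]
  · simp [← Finset.mul_sum, hv.2]

theorem derivWithin_mem_simplexTangent [Fintype V] {s : Finset V} {c : ℝ → V → ℝ}
    (hc : ∀ t ∈ Set.Icc (0 : ℝ) 1, c t ∈ closedSimplex s)
    (hd : ContDiffOn ℝ 1 c (Set.Icc 0 1)) {t : ℝ} (ht : t ∈ Set.Icc (0 : ℝ) 1) :
    derivWithin c (Set.Icc 0 1) t ∈ simplexTangent s := by
  have h : HasDerivWithinAt c (derivWithin c (Set.Icc 0 1) t) (Set.Icc 0 1) t :=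
    ((hd.differentiableOn one_ne_zero) t ht).hasDerivWithinAt
  have hu := uniqueDiffOn_Icc (zero_lt_one (α := ℝ)) t ht
  have key : ∀ (f : ℝ → ℝ) (d r : ℝ), HasDerivWithinAt f d (Set.Icc 0 1) t →
      (∀ u ∈ Set.Icc (0 : ℝ) 1, f u = r) → d = 0 := by
    intro f d r hf hconst
    have h0 : HasDerivWithinAt f 0 (Set.Icc 0 1) t :=
      (hasDerivWithinAt_const t (Set.Icc (0 : ℝ) 1) r).congr hconst (hconst t ht)
    exact hu.eq_deriv _ hf h0
  refine ⟨fun i hi => ?_, ?_⟩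
  · exact key (fun u => c u i) _ 0 (hasDerivWithinAt_pi.1 h i) fun u hu => (hc u hu).2.1 i hi
  · exact key (fun u => ∑ i ∈ s, c u i) _ 1
      (HasDerivWithinAt.fun_sum fun i _ => hasDerivWithinAt_pi.1 h i) fun u hu => (hc u hu).2.2

end Simplex

namespace RiemannianMetricOn

variable {V : Type u} [Fintype V] {K : AbstractSimplicialComplex V} (g : RiemannianMetricOn K)

/-- Smoothness is given only for fixed tangent vectors. Joint continuity follows by expanding in the
vectors `b i`, which span the tangent space and are tangent themselves. -/
theorem continuousOn_inner_self {s : Finset V} (hs : s ∈ K) :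
    ContinuousOn (fun q : (V → ℝ) × (V → ℝ) => g.inner s q.1 q.2 q.2)
      (closedSimplex s ×ˢ simplexTangent s) := by
  classical
  obtain ⟨v₀, hv₀⟩ : s.Nonempty := (K.isRelLowerSet_faces hs).1
  let b : V → V → ℝ := fun i => Pi.single i 1 - Pi.single v₀ 1
  have hb : ∀ i ∈ s, b i ∈ simplexTangent s := by
    intro i hi
    refine ⟨fun j hj => ?_, ?_⟩
    · have h1 : j ≠ i := fun h => hj (h ▸ hi)
      have h2 : j ≠ v₀ := fun h => hj (h ▸ hv₀)
      simp [b, h1, h2]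
    · simp [b, Finset.sum_sub_distrib, hi, hv₀]
  have hexp : ∀ v ∈ simplexTangent s, v = ∑ i ∈ s, v i • b i := by
    intro v hv
    funext j
    simp only [b, Finset.sum_apply, Pi.smul_apply, Pi.sub_apply, smul_eq_mul, mul_sub,
      Finset.sum_sub_distrib, ← Finset.sum_mul, hv.2, zero_mul, sub_zero]
    by_cases hj : j ∈ s
    · simp [Pi.single_apply, hj]
    · simp [Pi.single_apply, hj, hv.1 j hj]
  have heq : Set.EqOn (fun q : (V → ℝ) × (V → ℝ) => g.inner s q.1 q.2 q.2)
      (fun q => ∑ i ∈ s, ∑ j ∈ s, q.2 i * (q.2 j * g.inner s q.1 (b i) (b j)))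
      (closedSimplex s ×ˢ simplexTangent s) := by
    rintro ⟨x, v⟩ ⟨hx, hv⟩
    change g.inner s x v v = ∑ i ∈ s, ∑ j ∈ s, v i * (v j * g.inner s x (b i) (b j))
    conv_lhs => rw [hexp v hv]
    simp only [map_sum, map_smul, LinearMap.sum_apply, LinearMap.smul_apply, smul_eq_mul,
      Finset.mul_sum]
    rw [Finset.sum_comm]
    exact Finset.sum_congr rfl fun i _ => Finset.sum_congr rfl fun j _ => mul_left_comm _ _ _
  refine ContinuousOn.congr ?_ heq
  refine continuousOn_finsetSum _ fun i hi => continuousOn_finsetSum _ fun j hj => ?_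
  refine ContinuousOn.mul ((continuous_apply i).comp continuous_snd).continuousOn
    (ContinuousOn.mul ((continuous_apply j).comp continuous_snd).continuousOn ?_)
  exact (g.smooth s hs (b i) (hb i hi) (b j) (hb j hj)).continuousOn.comp continuousOn_fst
    fun q hq => hq.1

theorem sqrt_inner_smul (s : Finset V) (x v : V → ℝ) {r : ℝ} (hr : 0 ≤ r) :
    √(g.inner s x (r • v) (r • v)) = r * √(g.inner s x v v) := by
  simp only [map_smul, LinearMap.smul_apply, smul_eq_mul, ← mul_assoc]
  rw [Real.sqrt_mul (mul_nonneg hr hr), Real.sqrt_mul_self hr]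

/-- On each simplex the Riemannian norm is equivalent to the norm of the coordinate space. -/
theorem exists_norm_equiv {s : Finset V} (hs : s ∈ K) : ∃ C : ℝ, 0 < C ∧ ∀ x ∈ closedSimplex s,
    ∀ v ∈ simplexTangent s, √(g.inner s x v v) ≤ C * ‖v‖ ∧ ‖v‖ ≤ C * √(g.inner s x v v) := by
  have hcomp : IsCompact (closedSimplex s ×ˢ (simplexTangent s ∩ Metric.sphere 0 1)) :=
    (isCompact_closedSimplex s).prod
      ((isCompact_sphere (0 : V → ℝ) 1).inter_left (isClosed_simplexTangent s))
  have hcont : ContinuousOn (fun q : (V → ℝ) × (V → ℝ) => √(g.inner s q.1 q.2 q.2))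
      (closedSimplex s ×ˢ (simplexTangent s ∩ Metric.sphere 0 1)) :=
    Real.continuous_sqrt.comp_continuousOn ((g.continuousOn_inner_self hs).mono
      (Set.prod_mono le_rfl Set.inter_subset_left))
  have hpos : ∀ q ∈ closedSimplex s ×ˢ (simplexTangent s ∩ Metric.sphere 0 1),
      0 < √(g.inner s q.1 q.2 q.2) := by
    rintro ⟨x, v⟩ ⟨hx, hv, hv1⟩
    refine Real.sqrt_pos.2 (g.pos s hs x hx v hv ?_)
    rintro rfl
    simp at hv1
  obtain ⟨C₁, hC₁⟩ := (hcomp.image_of_continuousOn hcont).bddAbove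
  obtain ⟨C₂, hC₂⟩ := (hcomp.image_of_continuousOn
    (hcont.inv₀ fun q hq => (hpos q hq).ne')).bddAbove
  refine ⟨max 1 (max C₁ C₂), lt_max_of_lt_left one_pos, fun x hx v hv => ?_⟩
  rcases eq_or_ne v 0 with rfl | hv0
  · simp
  have hn : 0 < ‖v‖ := norm_pos_iff.2 hv0
  obtain ⟨u, hu⟩ : ∃ u, u = ‖v‖⁻¹ • v := ⟨_, rfl⟩
  have hvu : v = ‖v‖ • u := by rw [hu, smul_smul, mul_inv_cancel₀ hn.ne', one_smul]
  have hmem : ((x, u) : (V → ℝ) × (V → ℝ)) ∈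
      closedSimplex s ×ˢ (simplexTangent s ∩ Metric.sphere 0 1) := by
    refine ⟨hx, hu ▸ smul_mem_simplexTangent hv _, ?_⟩
    simp [hu, norm_smul, hn.ne']
  have h1 : √(g.inner s x u u) ≤ max 1 (max C₁ C₂) :=
    (hC₁ ⟨_, hmem, rfl⟩).trans ((le_max_left _ _).trans (le_max_right _ _))
  have h2 : (√(g.inner s x u u))⁻¹ ≤ max 1 (max C₁ C₂) :=
    (hC₂ ⟨_, hmem, rfl⟩).trans ((le_max_right _ _).trans (le_max_right _ _))
  have h3 : √(g.inner s x v v) = ‖v‖ * √(g.inner s x u u) := by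
    conv_lhs => rw [hvu]
    exact g.sqrt_inner_smul s x u hn.le
  have h4 := hpos _ hmem
  simp only at h4
  rw [h3]
  constructor
  · rw [mul_comm]
    exact mul_le_mul_of_nonneg_right h1 hn.le
  · rw [inv_le_iff_one_le_mul₀ h4] at h2
    calc ‖v‖ = ‖v‖ * 1 := (mul_one _).symm
      _ ≤ ‖v‖ * (max 1 (max C₁ C₂) * √(g.inner s x u u)) :=
        mul_le_mul_of_nonneg_left h2 hn.le
      _ = _ := by ring

theorem continuousOn_speed {s : Finset V} (hs : s ∈ K) {c : ℝ → V → ℝ}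
    (hc : ∀ t ∈ Set.Icc (0 : ℝ) 1, c t ∈ closedSimplex s)
    (hd : ContDiffOn ℝ 1 c (Set.Icc 0 1)) :
    ContinuousOn (fun t => √(g.inner s (c t) (derivWithin c (Set.Icc 0 1) t)
      (derivWithin c (Set.Icc 0 1) t))) (Set.Icc 0 1) := by
  have h1 : ContinuousOn (fun t => (c t, derivWithin c (Set.Icc 0 1) t)) (Set.Icc 0 1) :=
    hd.continuousOn.prodMk (hd.continuousOn_derivWithin (uniqueDiffOn_Icc zero_lt_one) le_rfl)
  exact Real.continuous_sqrt.comp_continuousOn ((g.continuousOn_inner_self hs).comp h1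
    fun t ht => ⟨hc t ht, derivWithin_mem_simplexTangent hc hd ht⟩)

theorem exists_norm_sub_le_simplexLength {s : Finset V} (hs : s ∈ K) : ∃ C : ℝ, 0 < C ∧
    ∀ c : ℝ → V → ℝ, (∀ t ∈ Set.Icc (0 : ℝ) 1, c t ∈ closedSimplex s) →
      ContDiffOn ℝ 1 c (Set.Icc 0 1) → ‖c 1 - c 0‖ ≤ C * g.simplexLength s c := by
  obtain ⟨C, hC, hCn⟩ := g.exists_norm_equiv hs
  refine ⟨C, hC, fun c hc hd => ?_⟩
  have hdc : ContinuousOn (derivWithin c (Set.Icc 0 1)) (Set.Icc 0 1) :=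
    hd.continuousOn_derivWithin (uniqueDiffOn_Icc zero_lt_one) le_rfl
  have hsp := g.continuousOn_speed hs hc hd
  have hdi := hdc.intervalIntegrable_of_Icc (μ := MeasureTheory.volume) zero_le_one
  have hsi := hsp.intervalIntegrable_of_Icc (μ := MeasureTheory.volume) zero_le_one
  have hftc := intervalIntegral.integral_eq_sub_of_hasDeriv_right_of_le zero_le_one
    hd.continuousOn (f' := derivWithin c (Set.Icc 0 1)) (fun t ht => by
      have h : HasDerivWithinAt c (derivWithin c (Set.Icc 0 1) t) (Set.Icc 0 1) t :=
        ((hd.differentiableOn one_ne_zero) t ⟨ht.1.le, ht.2.le⟩).hasDerivWithinAt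
      exact (h.hasDerivAt (Icc_mem_nhds ht.1 ht.2)).hasDerivWithinAt) hdi
  rw [← hftc]
  refine (intervalIntegral.norm_integral_le_integral_norm zero_le_one).trans ?_
  rw [simplexLength, ← intervalIntegral.integral_const_mul]
  refine intervalIntegral.integral_mono_on zero_le_one hdi.norm
    (hsi.const_mul C) fun t ht => ?_
  exact (hCn (c t) (hc t ht) _ (derivWithin_mem_simplexTangent hc hd ht)).2

theorem simplexLength_congr {s : Finset V} {c c' : ℝ → V → ℝ}
    (h : Set.EqOn c c' (Set.Icc 0 1)) : g.simplexLength s c = g.simplexLength s c' := by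
  refine intervalIntegral.integral_congr fun t ht => ?_
  rw [Set.uIcc_of_le zero_le_one] at ht
  rw [derivWithin_congr h (h ht), h ht]

theorem simplexLength_comp_affine {s : Finset V} {c : ℝ → V → ℝ}
    (hd : ContDiffOn ℝ 1 c (Set.Icc 0 1)) {a b : ℝ} (ha : 0 ≤ a) (hab : a ≤ b) (hb : b ≤ 1) :
    g.simplexLength s (fun t => c (a + (b - a) * t)) =
      ∫ t in a..b, √(g.inner s (c t) (derivWithin c (Set.Icc 0 1) t)
        (derivWithin c (Set.Icc 0 1) t)) := by
  have hmaps : Set.MapsTo (fun t : ℝ => a + (b - a) * t) (Set.Icc 0 1) (Set.Icc 0 1) := by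
    intro t ht
    have h1 := mul_nonneg (sub_nonneg.2 hab) ht.1
    have h2 := mul_le_mul_of_nonneg_left ht.2 (sub_nonneg.2 hab)
    exact ⟨by linarith, by linarith⟩
  have hder : ∀ t ∈ Set.Icc (0 : ℝ) 1,
      derivWithin (fun t => c (a + (b - a) * t)) (Set.Icc 0 1) t =
        (b - a) • derivWithin c (Set.Icc 0 1) (a + (b - a) * t) := by
    intro t ht
    have h1 : HasDerivWithinAt c (derivWithin c (Set.Icc 0 1) (a + (b - a) * t)) (Set.Icc 0 1)
        (a + (b - a) * t) :=
      ((hd.differentiableOn one_ne_zero) _ (hmaps ht)).hasDerivWithinAt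
    have h2 : HasDerivWithinAt (fun t : ℝ => a + (b - a) * t) (b - a) (Set.Icc 0 1) t := by
      simpa using ((hasDerivWithinAt_id t (Set.Icc (0 : ℝ) 1)).const_mul (b - a)).const_add a
    exact (h1.scomp t h2 hmaps).derivWithin (uniqueDiffOn_Icc zero_lt_one t ht)
  have h3 := intervalIntegral.smul_integral_comp_add_mul (a := 0) (b := 1)
    (fun t => √(g.inner s (c t) (derivWithin c (Set.Icc 0 1) t)
        (derivWithin c (Set.Icc 0 1) t))) (b - a) a
  rw [mul_zero, add_zero, mul_one, add_sub_cancel, smul_eq_mul,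
    ← intervalIntegral.integral_const_mul] at h3
  rw [← h3]
  refine intervalIntegral.integral_congr fun t ht => ?_
  rw [Set.uIcc_of_le zero_le_one] at ht
  simp only
  rw [hder t ht, g.sqrt_inner_smul s _ _ (sub_nonneg.2 hab)]

end RiemannianMetricOn

/-! ### The path distance as a length distance -/

namespace RiemannianMetricOn

variable {V : Type u} [Fintype V] {K : AbstractSimplicialComplex V} (g : RiemannianMetricOn K)
  {E : Type w} [TopologicalSpace E] (p : E → Realization K)

/-- The distance of `g.LengthSpace p`, on the points of `E`. -/
noncomputable def pathEDist (a b : E) : ℝ≥0∞ := edist (α := g.LengthSpace p) a b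

theorem pathEDist_self (a : E) : g.pathEDist p a a = 0 := edist_self (α := g.LengthSpace p) a

theorem pathEDist_comm (a b : E) : g.pathEDist p a b = g.pathEDist p b a :=
  edist_comm (α := g.LengthSpace p) a b

theorem pathEDist_triangle (a b c : E) :
    g.pathEDist p a c ≤ g.pathEDist p a b + g.pathEDist p b c :=
  edist_triangle (α := g.LengthSpace p) a b c

variable {g p}

theorem IsPathLength.pathEDist_le {a b : E} {ℓ : ℝ≥0∞} (h : g.IsPathLength p a b ℓ) :
    g.pathEDist p a b ≤ ℓ :=
  sInf_le h

theorem IsSegmentLength.isPathLength {a b : E} {ℓ : ℝ≥0∞} (h : g.IsSegmentLength p a b ℓ) :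
    g.IsPathLength p a b ℓ := by
  simpa using IsPathLength.cons h (.refl b)

theorem exists_isPathLength_of_pathEDist_lt {a b : E} {ε : ℝ≥0∞} (h : g.pathEDist p a b < ε) :
    ∃ ℓ < ε, g.IsPathLength p a b ℓ := by
  obtain ⟨ℓ, hℓ, h⟩ := sInf_lt_iff.1 h
  exact ⟨ℓ, h, hℓ⟩

theorem isSegmentLength_subpath {a b : E} (γ : Path a b) {s : Finset V} (hs : s ∈ K)
    (hmem : ∀ t ∈ Set.Icc (0 : ℝ) 1, pathCoords p γ t ∈ closedSimplex s)
    (hd : ContDiffOn ℝ 1 (pathCoords p γ) (Set.Icc 0 1)) {t₀ t₁ : unitInterval} (h : t₀ ≤ t₁) :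
    g.IsSegmentLength p (γ t₀) (γ t₁) (ENNReal.ofReal (∫ t in (t₀ : ℝ)..t₁,
      √(g.inner s (pathCoords p γ t) (derivWithin (pathCoords p γ) (Set.Icc 0 1) t)
        (derivWithin (pathCoords p γ) (Set.Icc 0 1) t)))) := by
  have h' : (t₀ : ℝ) ≤ t₁ := h
  have hmaps : Set.MapsTo (fun t : ℝ => (t₀ : ℝ) + (t₁ - t₀) * t) (Set.Icc 0 1)
      (Set.Icc 0 1) := by
    intro t ht
    have h1 := mul_nonneg (sub_nonneg.2 h') ht.1
    have h2 := mul_le_mul_of_nonneg_left ht.2 (sub_nonneg.2 h')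
    exact ⟨by linarith [t₀.2.1], by linarith [t₁.2.2]⟩
  have heq : Set.EqOn (pathCoords p (γ.subpath t₀ t₁))
      (fun t => pathCoords p γ (t₀ + (t₁ - t₀) * t)) (Set.Icc 0 1) := by
    intro t ht
    have h3 := hmaps ht
    simp only [pathCoords, Path.extend_apply _ ht, Path.extend_apply _ h3]
    congr 2
    change γ _ = γ _
    congr 1
    apply Subtype.ext
    change (1 - t) * (t₀ : ℝ) + t * t₁ = t₀ + (t₁ - t₀) * t
    ring
  refine ⟨γ.subpath t₀ t₁, s, hs, fun t ht => ?_, ?_, ?_⟩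
  · rw [heq ht]
    exact hmem _ (hmaps ht)
  · refine ContDiffOn.congr ?_ heq
    exact hd.comp (by fun_prop) hmaps
  · rw [g.simplexLength_congr heq, g.simplexLength_comp_affine hd t₀.2.1 h' t₁.2.2]

theorem IsSegmentLength.exists_path {a b : E} {ℓ : ℝ≥0∞} (h : g.IsSegmentLength p a b ℓ) :
    ∃ γ : Path a b, ∀ t, ∃ ℓ₁ ℓ₂, g.IsPathLength p a (γ t) ℓ₁ ∧ g.IsPathLength p (γ t) b ℓ₂ ∧
      ℓ₁ + ℓ₂ = ℓ := by
  obtain ⟨γ, s, hs, hmem, hd, rfl⟩ := h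
  refine ⟨γ, fun t => ?_⟩
  have h1 := isSegmentLength_subpath (g := g) γ hs hmem hd (t₀ := 0) (t₁ := t) t.2.1
  have h2 := isSegmentLength_subpath (g := g) γ hs hmem hd (t₀ := t) (t₁ := 1) t.2.2
  rw [γ.source] at h1
  rw [γ.target] at h2
  refine ⟨_, _, h1.isPathLength, h2.isPathLength, ?_⟩
  have hsp := g.continuousOn_speed hs hmem hd
  have hi : ∀ x y : unitInterval, IntervalIntegrable (fun t =>
      √(g.inner s (pathCoords p γ t) (derivWithin (pathCoords p γ) (Set.Icc 0 1) t)
        (derivWithin (pathCoords p γ) (Set.Icc 0 1) t))) MeasureTheory.volume x y := by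
    intro x y
    refine (hsp.mono ?_).intervalIntegrable
    exact Set.uIcc_subset_Icc x.2 y.2
  rw [← ENNReal.ofReal_add, intervalIntegral.integral_add_adjacent_intervals (hi _ _) (hi _ _)]
  · rfl
  · exact intervalIntegral.integral_nonneg t.2.1 fun _ _ => Real.sqrt_nonneg _
  · exact intervalIntegral.integral_nonneg t.2.2 fun _ _ => Real.sqrt_nonneg _

theorem IsPathLength.exists_path {a b : E} {ℓ : ℝ≥0∞} (h : g.IsPathLength p a b ℓ) :
    ∃ γ : Path a b, ∀ t, ∃ ℓ₁ ℓ₂, g.IsPathLength p a (γ t) ℓ₁ ∧ g.IsPathLength p (γ t) b ℓ₂ ∧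
      ℓ₁ + ℓ₂ = ℓ := by
  induction h with
  | refl a => exact ⟨Path.refl a, fun t => ⟨0, 0, .refl a, .refl a, add_zero 0⟩⟩
  | @cons a b c ℓ ℓ' hs hp ih =>
    obtain ⟨γ₁, h₁⟩ := hs.exists_path
    obtain ⟨γ₂, h₂⟩ := ih
    refine ⟨γ₁.trans γ₂, fun t => ?_⟩
    have ht : γ₁.trans γ₂ t ∈ Set.range γ₁ ∪ Set.range γ₂ := by
      rw [← Path.trans_range]
      exact Set.mem_range_self t
    rcases ht with ⟨u, hu⟩ | ⟨u, hu⟩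
    · obtain ⟨x, y, hx, hy, hxy⟩ := h₁ u
      rw [hu] at hx hy
      exact ⟨x, y + ℓ', hx, hy.trans hp, by rw [← add_assoc, hxy]⟩
    · obtain ⟨x, y, hx, hy, hxy⟩ := h₂ u
      rw [hu] at hx hy
      exact ⟨ℓ + x, y, .cons hs hx, hy, by rw [add_assoc, hxy]⟩

theorem exists_path_of_pathEDist_lt {a b : E} {ε : ℝ≥0∞} (h : g.pathEDist p a b < ε) :
    ∃ γ : Path a b, ∀ t, g.pathEDist p a (γ t) + g.pathEDist p (γ t) b < ε := by
  obtain ⟨ℓ, hℓ, h⟩ := exists_isPathLength_of_pathEDist_lt h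
  obtain ⟨γ, hγ⟩ := h.exists_path
  refine ⟨γ, fun t => ?_⟩
  obtain ⟨x, y, hx, hy, rfl⟩ := hγ t
  exact (add_le_add hx.pathEDist_le hy.pathEDist_le).trans_lt hℓ

theorem pathEDist_le_of_lineMap {s : Finset V} (hs : s ∈ K) {C : ℝ} (hC : ∀ x ∈ closedSimplex s,
      ∀ v ∈ simplexTangent s, √(g.inner s x v v) ≤ C * ‖v‖) {a b : E} (γ : Path a b)
    {x y : V → ℝ} (hx : x ∈ closedSimplex s) (hy : y ∈ closedSimplex s)
    (hγ : ∀ t ∈ Set.Icc (0 : ℝ) 1, pathCoords p γ t = AffineMap.lineMap x y t) :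
    g.pathEDist p a b ≤ ENNReal.ofReal (C * ‖y - x‖) := by
  have hmem : ∀ t ∈ Set.Icc (0 : ℝ) 1, AffineMap.lineMap x y t ∈ closedSimplex s := fun t ht =>
    (convex_closedSimplex s).lineMap_mem hx hy ht
  have hseg : g.IsSegmentLength p a b (ENNReal.ofReal (g.simplexLength s (pathCoords p γ))) := by
    refine ⟨γ, s, hs, fun t ht => hγ t ht ▸ hmem t ht, ?_, rfl⟩
    have h : ContDiff ℝ 1 fun t : ℝ => t • (y - x) + x := by fun_prop
    exact h.contDiffOn.congr fun t ht => by rw [hγ t ht, AffineMap.lineMap_apply_module']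
  refine hseg.isPathLength.pathEDist_le.trans (ENNReal.ofReal_le_ofReal ?_)
  rw [g.simplexLength_congr hγ]
  refine (le_abs_self _).trans ?_
  rw [simplexLength, ← Real.norm_eq_abs]
  refine (intervalIntegral.norm_integral_le_of_norm_le_const (C := C * ‖y - x‖)
    fun t ht => ?_).trans (by simp)
  rw [Set.uIoc_of_le zero_le_one] at ht
  have ht' : t ∈ Set.Icc (0 : ℝ) 1 := ⟨ht.1.le, ht.2⟩
  have hder : derivWithin (fun t => AffineMap.lineMap x y t) (Set.Icc (0 : ℝ) 1) t = y - x :=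
    (AffineMap.hasDerivWithinAt_lineMap).derivWithin (uniqueDiffOn_Icc zero_lt_one t ht')
  rw [Real.norm_of_nonneg (Real.sqrt_nonneg _), hder]
  exact hC _ (hmem t ht') _ (sub_mem_simplexTangent hx hy)

/-- In the weak topology openness is tested on each simplex. There, nearby points are joined by a
straight segment of small Riemannian length, which the local inverse of `p` carries to `E`. -/
theorem isOpen_pathEDist_lt (hp : IsLocalHomeomorph p) (a : E) (ε : ℝ≥0∞) :
    IsOpen {b | g.pathEDist p a b < ε} := by
  rw [isOpen_iff_mem_nhds]
  intro x hx
  obtain ⟨φ, hxφ, rfl⟩ := hp x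
  have hU : IsOpen (φ.target ∩ {z | g.pathEDist φ a (φ.symm z) < ε}) := by
    rw [Realization.isOpen_iff]
    rintro ⟨s, hs⟩
    obtain ⟨C, hC, hCn⟩ := g.exists_norm_equiv hs
    rw [Metric.isOpen_iff]
    rintro z ⟨hzt, hzε⟩
    have hop : IsOpen (simplexInclusion K ⟨s, hs⟩ ⁻¹' φ.target) :=
      φ.open_target.preimage (Realization.continuous_simplexInclusion _)
    obtain ⟨r, hr, hrt⟩ := Metric.isOpen_iff.1 hop z hzt
    obtain ⟨η, hη, hηε⟩ : ∃ η : ℝ, 0 < η ∧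
        g.pathEDist φ a (φ.symm (simplexInclusion K ⟨s, hs⟩ z)) + ENNReal.ofReal η < ε := by
      obtain ⟨d, hd, hdε⟩ := ENNReal.lt_iff_exists_add_pos_lt.1 hzε
      exact ⟨d, hd, by simpa using hdε⟩
    refine ⟨min r (η / C), lt_min hr (div_pos hη hC), fun y hy => ?_⟩
    have hyr : dist y z < r := (Metric.mem_ball.1 hy).trans_le (min_le_left _ _)
    have hyη : dist y z < η / C := (Metric.mem_ball.1 hy).trans_le (min_le_right _ _)
    refine ⟨hrt hyr, ?_⟩
    let l : unitInterval → closedSimplex s := fun t =>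
      ⟨AffineMap.lineMap z.1 y.1 (t : ℝ), (convex_closedSimplex s).lineMap_mem z.2 y.2 t.2⟩
    have hl : Continuous l := by
      refine Continuous.subtype_mk ?_ _
      exact AffineMap.lineMap_continuous.comp continuous_subtype_val
    have hlt : ∀ t, simplexInclusion K ⟨s, hs⟩ (l t) ∈ φ.target := by
      intro t
      refine hrt ?_
      rw [Metric.mem_ball, Subtype.dist_eq]
      change dist (AffineMap.lineMap z.1 y.1 (t : ℝ)) z.1 < r
      rw [dist_lineMap_left, Real.norm_of_nonneg t.2.1, dist_comm]
      exact (mul_le_of_le_one_left dist_nonneg t.2.2).trans_lt hyr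
    let γ : Path (φ.symm (simplexInclusion K ⟨s, hs⟩ z))
        (φ.symm (simplexInclusion K ⟨s, hs⟩ y)) :=
      { toFun := fun t => φ.symm (simplexInclusion K ⟨s, hs⟩ (l t))
        continuous_toFun := φ.continuousOn_symm.comp_continuous
          ((Realization.continuous_simplexInclusion _).comp hl) hlt
        source' := by
          congr 2
          exact Subtype.ext (AffineMap.lineMap_apply_zero _ _)
        target' := by
          congr 2
          exact Subtype.ext (AffineMap.lineMap_apply_one _ _) }
    have hγ : ∀ t ∈ Set.Icc (0 : ℝ) 1, pathCoords φ γ t = AffineMap.lineMap z.1 y.1 t := by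
      intro t ht
      rw [pathCoords, Path.extend_apply _ ht]
      change (φ (φ.symm (simplexInclusion K ⟨s, hs⟩ (l ⟨t, ht⟩)))).1 = _
      rw [φ.right_inv (hlt _)]
      rfl
    have hle := pathEDist_le_of_lineMap (g := g) hs (fun x hx v hv => (hCn x hx v hv).1) γ z.2
      y.2 hγ
    refine lt_of_le_of_lt (g.pathEDist_triangle φ _
      (φ.symm (simplexInclusion K ⟨s, hs⟩ z)) _) (lt_of_le_of_lt ?_ hηε)
    refine add_le_add le_rfl (hle.trans (ENNReal.ofReal_le_ofReal ?_))
    rw [lt_div_iff₀ hC, Subtype.dist_eq, dist_eq_norm] at hyη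
    linarith
  refine Filter.mem_of_superset ((φ.isOpen_inter_preimage hU).mem_nhds
    ⟨hxφ, φ.map_source hxφ, ?_⟩) ?_
  · simpa [φ.left_inv hxφ] using hx
  · rintro y ⟨hy, -, hy'⟩
    simpa [φ.left_inv hy] using hy'

/-- The constant is a sum over all vertex sets, hence uniform over the finitely many simplices; it
controls coordinates from above by length, independently of the space over the polyhedron. -/
theorem exists_norm_sub_le (g : RiemannianMetricOn K) : ∃ C : ℝ, 0 < C ∧
    ∀ {E : Type w} [TopologicalSpace E] {p : E → Realization K} (a b : E),
      ENNReal.ofReal ‖(p a).1 - (p b).1‖ ≤ ENNReal.ofReal C * g.pathEDist p a b := by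
  classical
  have h : ∀ s : Finset V, ∃ C : ℝ, 0 < C ∧ (s ∈ K → ∀ c : ℝ → V → ℝ,
      (∀ t ∈ Set.Icc (0 : ℝ) 1, c t ∈ closedSimplex s) →
        ContDiffOn ℝ 1 c (Set.Icc 0 1) → ‖c 1 - c 0‖ ≤ C * g.simplexLength s c) := by
    intro s
    by_cases hs : s ∈ K
    · obtain ⟨C, hC, h⟩ := g.exists_norm_sub_le_simplexLength hs
      exact ⟨C, hC, fun _ => h⟩
    · exact ⟨1, one_pos, fun h => absurd h hs⟩
  choose C hC hCs using h
  refine ⟨∑ s, C s, Finset.sum_pos (fun s _ => hC s) Finset.univ_nonempty, fun {E} _ {p} a b => ?_⟩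
  have hC0 : 0 < ∑ s, C s := Finset.sum_pos (fun s _ => hC s) Finset.univ_nonempty
  rw [mul_comm, ← ENNReal.div_le_iff (by simpa using hC0) ENNReal.ofReal_ne_top]
  refine le_sInf fun ℓ hℓ => ?_
  rw [ENNReal.div_le_iff (by simpa using hC0) ENNReal.ofReal_ne_top, mul_comm]
  induction hℓ with
  | refl a => simp
  | @cons a b c ℓ ℓ' hs _ ih =>
    rw [mul_add]
    obtain ⟨γ, s, hs, hmem, hd, rfl⟩ := hs
    have h1 := hCs s hs _ hmem hd
    simp only [pathCoords, Path.extend_zero, Path.extend_one] at h1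
    have h2 : ‖(p a).1 - (p b).1‖ ≤ (∑ s, C s) * g.simplexLength s (pathCoords p γ) := by
      rw [norm_sub_rev]
      refine h1.trans (mul_le_mul_of_nonneg_right
        (Finset.single_le_sum (fun s _ => (hC s).le) (Finset.mem_univ s)) ?_)
      exact intervalIntegral.integral_nonneg zero_le_one fun _ _ => Real.sqrt_nonneg _
    rw [← ENNReal.ofReal_mul hC0.le]
    calc ENNReal.ofReal ‖(p a).1 - (p c).1‖
        ≤ ENNReal.ofReal (‖(p a).1 - (p b).1‖ + ‖(p b).1 - (p c).1‖) :=
          ENNReal.ofReal_le_ofReal (norm_sub_le_norm_sub_add_norm_sub _ _ _)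
      _ = ENNReal.ofReal ‖(p a).1 - (p b).1‖ + ENNReal.ofReal ‖(p b).1 - (p c).1‖ :=
          ENNReal.ofReal_add (norm_nonneg _) (norm_nonneg _)
      _ ≤ _ := add_le_add (ENNReal.ofReal_le_ofReal h2) ih

theorem pathEDist_ne_top [PreconnectedSpace E] (hp : IsLocalHomeomorph p) (a b : E) :
    g.pathEDist p a b ≠ ⊤ := by
  have h1 : IsOpen {b | g.pathEDist p a b < ⊤} := isOpen_pathEDist_lt hp a ⊤
  have h2 : IsClosed {b | g.pathEDist p a b < ⊤} := by
    rw [← isOpen_compl_iff, isOpen_iff_mem_nhds]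
    intro x hx
    refine Filter.mem_of_superset ((isOpen_pathEDist_lt (g := g) hp x ⊤).mem_nhds
      (by simp [pathEDist_self])) fun y hy hy' => hx ?_
    have hy1 : g.pathEDist p x y < ⊤ := hy
    have hy2 : g.pathEDist p a y < ⊤ := hy'
    rw [pathEDist_comm] at hy1
    exact (g.pathEDist_triangle p a y x).trans_lt (ENNReal.add_lt_top.2 ⟨hy2, hy1⟩)
  have h3 := IsClopen.eq_univ ⟨h2, h1⟩ ⟨a, by simp [pathEDist_self]⟩
  have h4 : b ∈ {b | g.pathEDist p a b < ⊤} := h3 ▸ Set.mem_univ b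
  exact h4.ne

theorem isLengthDist [PreconnectedSpace E] (hp : IsLocalHomeomorph p) :
    IsLengthDist fun a b => (g.pathEDist p a b).toReal := by
  have ht := fun a b => pathEDist_ne_top (g := g) hp a b
  have hlt : ∀ a b ℓ, (g.pathEDist p a b).toReal < ℓ ↔
      g.pathEDist p a b < ENNReal.ofReal ℓ := fun a b ℓ =>
    (ENNReal.lt_ofReal_iff_toReal_lt (ht a b)).symm
  refine ⟨fun a => by simp [pathEDist_self], fun a b => by rw [pathEDist_comm], fun a b c => ?_,
    fun a ε => ?_, fun {a b ℓ} h => ?_⟩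
  · rw [← ENNReal.toReal_add (ht _ _) (ht _ _)]
    exact ENNReal.toReal_mono (ENNReal.add_ne_top.2 ⟨ht _ _, ht _ _⟩)
      (g.pathEDist_triangle p a b c)
  · simp only [hlt]
    exact isOpen_pathEDist_lt hp a _
  · rw [hlt] at h
    obtain ⟨γ, hγ⟩ := exists_path_of_pathEDist_lt h
    refine ⟨γ, fun t => ?_⟩
    rw [← ENNReal.toReal_add (ht _ _) (ht _ _)]
    exact (ENNReal.lt_ofReal_iff_toReal_lt (ENNReal.add_ne_top.2 ⟨ht _ _, ht _ _⟩)).1 (hγ t)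

end RiemannianMetricOn

/-! ### Local topology, coverings and compactness of balls -/

namespace Realization

theorem locallyPathConnectedSpace {W : Type*} (L : AbstractSimplicialComplex W) :
    LocallyPathConnectedSpace (Realization L) := by
  have (s : {s : Finset W // s ∈ L}) : LocallyPathConnectedSpace (closedSimplex s.1) :=
    (convex_closedSimplex s.1).locallyPathConnectedSpace
  let F : (Σ s : {s : Finset W // s ∈ L}, closedSimplex s.1) → Realization L :=
    fun q => simplexInclusion L q.1 q.2
  have hF : Topology.IsQuotientMap F := by
    refine ⟨Topology.isCoinducing_iff.2 fun U => ?_, ?_⟩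
    · rw [isOpen_iff, isOpen_sigma_iff]
      rfl
    · rintro ⟨x, s, hs, hx⟩
      exact ⟨⟨⟨s, hs⟩, x, hx⟩, rfl⟩
  exact hF.locallyPathConnectedSpace

variable {V : Type u} [Fintype V] (K : AbstractSimplicialComplex V)

instance compactSpace : CompactSpace (Realization K) := by
  have hcover : (Set.univ : Set (Realization K)) =
      ⋃ s : {s : Finset V // s ∈ K}, Set.range (simplexInclusion K s) := by
    refine (Set.eq_univ_of_forall ?_).symm
    rintro ⟨x, s, hs, hx⟩
    exact Set.mem_iUnion.2 ⟨⟨s, hs⟩, ⟨x, hx⟩, rfl⟩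
  refine ⟨hcover ▸ isCompact_iUnion fun s => ?_⟩
  have := isCompact_iff_compactSpace.1 (isCompact_closedSimplex s.1)
  exact isCompact_range (continuous_simplexInclusion s)

instance t2Space {W : Type*} (L : AbstractSimplicialComplex W) : T2Space (Realization L) :=
  T2Space.of_injective_continuous Subtype.val_injective continuous_val

theorem isEmbedding_val : Topology.IsEmbedding (fun y : Realization K => y.1) :=
  (continuous_val.isClosedEmbedding Subtype.val_injective).isEmbedding

end Realization

theorem IsLocalHomeomorph.locallyPathConnectedSpace {E X : Type*} [TopologicalSpace E]
    [TopologicalSpace X] [LocallyPathConnectedSpace X] {p : E → X} (hp : IsLocalHomeomorph p) :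
    LocallyPathConnectedSpace E := by
  refine ⟨fun x => Filter.hasBasis_self.2 fun t ht => ?_⟩
  obtain ⟨φ, hx, -⟩ := hp x
  have h1 : φ.target ∩ φ.symm ⁻¹' t ∈ nhds (φ x) :=
    Filter.inter_mem (φ.open_target.mem_nhds (φ.map_source hx))
      ((φ.continuousAt_symm (φ.map_source hx)).preimage_mem_nhds (by rwa [φ.left_inv hx]))
  obtain ⟨s, ⟨hs, hsc⟩, hst⟩ := (path_connected_basis (φ x)).mem_iff.1 h1
  replace hst : s ⊆ φ.target ∩ φ.symm ⁻¹' t := hst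
  refine ⟨φ.symm '' s, ?_, ?_, ?_⟩
  · rw [φ.symm.image_eq_target_inter_inv_preimage fun y hy => (hst hy).1]
    exact Filter.inter_mem (φ.open_source.mem_nhds hx)
      ((φ.continuousAt hx).preimage_mem_nhds hs)
  · exact hsc.image' (φ.continuousOn_symm.mono fun y hy => (hst hy).1)
  · rintro _ ⟨y, hy, rfl⟩
    exact (hst hy).2

/-- Over a compact set inside an evenly covered one, a path cannot change sheet, so it stays in a
compact copy. -/
theorem IsCoveringMap.exists_nhds_isCompact {E X : Type*} [TopologicalSpace E] [TopologicalSpace X]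
    [LocallyCompactSpace X] {p : E → X} (hp : IsCoveringMap p) (x : X) :
    ∃ C ∈ nhds x, ∀ e, p e ∈ C → ∃ A : Set E, IsCompact A ∧
      ∀ e', JoinedIn (p ⁻¹' C) e e' → e' ∈ A := by
  obtain ⟨_, U, hxU, hU, -, H, hH⟩ := hp x
  obtain ⟨C, hC, hCU, hCc⟩ := local_compact_nhds (hU.mem_nhds hxU)
  refine ⟨C, hC, fun e he => ?_⟩
  obtain ⟨i, hi⟩ : ∃ i, i = (H ⟨e, hCU he⟩).2 := ⟨_, rfl⟩
  have hc : IsCompact (Subtype.val ⁻¹' C : Set U) := by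
    rw [Subtype.isCompact_iff, Subtype.image_preimage_coe, Set.inter_eq_right.2 hCU]
    exact hCc
  refine ⟨Subtype.val '' (H.symm '' ((Subtype.val ⁻¹' C : Set U) ×ˢ {i})),
    ((hc.prod isCompact_singleton).image H.symm.continuous).image continuous_subtype_val,
    fun e' ⟨γ, hγ⟩ => ?_⟩
  have hconst := PreconnectedSpace.constant (inferInstance : PreconnectedSpace unitInterval)
    (f := fun t => (H ⟨γ t, hCU (hγ t)⟩).2) (by fun_prop) (x := 0) (y := 1)
  simp only [γ.source, γ.target] at hconst
  have he' : p e' ∈ C := by simpa using hγ 1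
  refine ⟨⟨e', hCU he'⟩, ⟨H ⟨e', hCU he'⟩, ⟨?_, ?_⟩, H.symm_apply_apply _⟩, rfl⟩
  · change (H ⟨e', hCU he'⟩).1.1 ∈ C
    rwa [hH]
  · exact hconst.symm.trans hi.symm

/-- The Hopf–Rinow argument: local compactness at a uniform scale `ε` propagates outwards in steps
of `ε / 4`, because almost shortest paths pass through intermediate balls. -/
theorem IsLengthDist.exists_isCompact {E : Type*} [TopologicalSpace E] {D : E → E → ℝ}
    (hD : IsLengthDist D) {ε : ℝ} (hε : 0 < ε)
    (hloc : ∀ x, ∃ A, IsCompact A ∧ {y | D x y < ε} ⊆ A) (e : E) (R : ℝ) :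
    ∃ A, IsCompact A ∧ {y | D e y < R} ⊆ A := by
  classical
  choose C hC hCs using hloc
  have key : ∀ n : ℕ, ∃ A, IsCompact A ∧ {y | D e y < (n + 1) * (ε / 4)} ⊆ A := by
    intro n
    induction n with
    | zero =>
      refine ⟨C e, hC e, fun y hy => hCs e ?_⟩
      have hy' : D e y < ((0 : ℕ) + 1) * (ε / 4) := hy
      push_cast at hy'
      change D e y < ε
      linarith
    | succ n ih =>
      obtain ⟨A, hA, hAs⟩ := ih
      obtain ⟨t, -, ht⟩ := hA.elim_nhds_subcover (fun x => {y | D x y < ε / 2}) fun x _ =>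
        (hD.isOpen_ball x _).mem_nhds (by simpa [hD.self] using hε)
      refine ⟨⋃ x ∈ t, C x, t.isCompact_biUnion fun x _ => hC x, fun y hy => ?_⟩
      have hy' : D e y < ((n + 1 : ℕ) + 1) * (ε / 4) := hy
      push_cast at hy'
      obtain ⟨x, hx, hxy⟩ : ∃ x, D e x < (n + 1) * (ε / 4) ∧ D x y < ε / 2 := by
        by_cases hlt : D e y < (n + 1) * (ε / 4)
        · exact ⟨y, hlt, by rw [hD.self]; linarith⟩
        obtain ⟨γ, hγ⟩ := hD.exists_path hy'
        -- At this height the point lies in the previous ball, and the remaining distance to `y` is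
        -- below `3 / 2 * (ε / 4) < ε / 2`.
        obtain ⟨s, hs⟩ : ∃ s, D e (γ s) = (n + 1 / 2) * (ε / 4) := by
          refine mem_range_of_exists_le_of_exists_ge ((hD.continuous e).comp γ.continuous)
            ⟨0, ?_⟩ ⟨1, ?_⟩
          · simp only [γ.source, hD.self]
            positivity
          · simp only [γ.target]
            nlinarith
        refine ⟨γ s, by rw [hs]; nlinarith, ?_⟩
        have := hγ s
        rw [hs] at this
        nlinarith
      obtain ⟨z, hz, hzx⟩ := Set.mem_iUnion₂.1 (ht (hAs hx))
      refine Set.mem_iUnion₂.2 ⟨z, hz, hCs z ?_⟩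
      have h1 : D z x < ε / 2 := hzx
      have h2 := hD.triangle z x y
      change D z y < ε
      linarith
  obtain ⟨n, hn⟩ := exists_nat_gt (R / (ε / 4))
  rw [div_lt_iff₀ (by positivity)] at hn
  obtain ⟨A, hA, hAs⟩ := key n
  refine ⟨A, hA, fun y hy => hAs ?_⟩
  have hy' : D e y < R := hy
  change D e y < (n + 1) * (ε / 4)
  nlinarith

namespace RiemannianMetricOn

variable {V : Type u} [Fintype V] {K : AbstractSimplicialComplex V} {g : RiemannianMetricOn K}
  {E : Type w} [TopologicalSpace E] {p : E → Realization K}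

theorem exists_isCompact_of_isCoveringMap [PreconnectedSpace E] (hp : IsCoveringMap p) (e : E)
    (R : ℝ) : ∃ A, IsCompact A ∧ {y | (g.pathEDist p e y).toReal < R} ⊆ A := by
  have hD := isLengthDist (g := g) hp.isLocalHomeomorph
  obtain ⟨c, hc, hcle⟩ := g.exists_norm_sub_le
  let _ : MetricSpace (Realization K) := (Realization.isEmbedding_val K).comapMetricSpace _
  choose C hC hCs using hp.exists_nhds_isCompact
  -- Compactness of the base supplies the uniform scale: balls of radius `δ / c` project into a
  -- single compact evenly covered set.
  obtain ⟨δ, hδ, hδC⟩ := lebesgue_number_lemma_of_metric (isCompact_univ (X := Realization K))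
    (fun x => isOpen_interior (s := C x)) fun x _ =>
      Set.mem_iUnion.2 ⟨x, mem_interior_iff_mem_nhds.2 (hC x)⟩
  refine hD.exists_isCompact (ε := δ / c) (by positivity) (fun x => ?_) e R
  obtain ⟨i, hi⟩ := hδC (p x) (Set.mem_univ _)
  have hball : ∀ y, (g.pathEDist p x y).toReal < δ / c → p y ∈ C i := by
    intro y hy
    refine interior_subset (hi ?_)
    rw [Metric.mem_ball, dist_comm]
    change dist (p x).1 (p y).1 < δ
    have h1 := hcle (p := p) x y
    rw [← ENNReal.ofReal_toReal (pathEDist_ne_top (g := g) hp.isLocalHomeomorph x y),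
      ← ENNReal.ofReal_mul hc.le,
      ENNReal.ofReal_le_ofReal_iff (mul_nonneg hc.le ENNReal.toReal_nonneg)] at h1
    rw [lt_div_iff₀ hc] at hy
    rw [dist_eq_norm]
    linarith
  obtain ⟨A, hA, hAs⟩ := hCs i x (hball x (by
    rw [pathEDist_self, ENNReal.toReal_zero]
    positivity))
  exact ⟨A, hA, fun y hy => hAs y ((hD.joinedIn_ball hy).mono hball)⟩

theorem finite_fiber_inter_ball [PreconnectedSpace E] (hp : IsCoveringMap p) (e : E)
    (x : Realization K) (R : ℝ) :
    {y | p y = x ∧ (g.pathEDist p e y).toReal < R}.Finite := by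
  obtain ⟨A, hA, hAs⟩ := exists_isCompact_of_isCoveringMap (g := g) hp e R
  have h1 : IsCompact (A ∩ p ⁻¹' {x}) := hA.inter_right (isClosed_singleton.preimage hp.continuous)
  have h2 : IsDiscrete (p ⁻¹' {x}) := ⟨(hp x).discreteTopology_fiber⟩
  exact (h1.finite (h2.mono Set.inter_subset_right)).subset fun y hy => ⟨hAs hy.2, hy.1⟩

theorem IsPathLength.map {E' : Type*} [TopologicalSpace E'] {p' : E' → Realization K} {ψ : E → E'}
    (hψ : Continuous ψ) (hp : ∀ x, p' (ψ x) = p x) {a b : E} {ℓ : ℝ≥0∞}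
    (h : g.IsPathLength p a b ℓ) : g.IsPathLength p' (ψ a) (ψ b) ℓ := by
  induction h with
  | refl a => exact .refl _
  | cons hs _ ih =>
    refine .cons ?_ ih
    obtain ⟨γ, s, hs, hmem, hd, rfl⟩ := hs
    have h : pathCoords p' (γ.map hψ) = pathCoords p γ := by
      funext t
      change (p' (ψ (γ.extend t))).1 = _
      rw [hp]
      rfl
    exact ⟨γ.map hψ, s, hs, h.symm ▸ hmem, h.symm ▸ hd, by rw [h]⟩

theorem pathEDist_map_le {E' : Type*} [TopologicalSpace E'] {p' : E' → Realization K} {ψ : E → E'}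
    (hψ : Continuous ψ) (hp : ∀ x, p' (ψ x) = p x) (a b : E) :
    g.pathEDist p' (ψ a) (ψ b) ≤ g.pathEDist p a b :=
  le_sInf fun _ hℓ => (IsPathLength.map hψ hp hℓ).pathEDist_le

/-- Together with `pathEDist_map_le`, this makes the distance to a point downstairs equal to the
distance to its fiber upstairs. -/
theorem IsPathLength.exists_lift (hp : IsCoveringMap p) {x y : Realization K} {ℓ : ℝ≥0∞}
    (h : g.IsPathLength id x y ℓ) :
    ∀ a, p a = x → ∃ b, p b = y ∧ g.IsPathLength p a b ℓ := by
  induction h with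
  | refl x => exact fun a ha => ⟨a, ha, .refl a⟩
  | @cons x y z ℓ ℓ' hs _ ih =>
    intro a ha
    obtain ⟨γ, s, hs, hmem, hd, rfl⟩ := hs
    obtain ⟨Γ, hΓ, hΓ0⟩ := hp.exists_path_lifts γ.toContinuousMap a (by simp [ha])
    obtain ⟨b, hb, hbℓ⟩ := ih (Γ 1) ((congrFun hΓ 1).trans γ.target)
    refine ⟨b, hb, .cons ?_ hbℓ⟩
    let γ' : Path a (Γ 1) := ⟨Γ, hΓ0, rfl⟩
    have h : pathCoords p γ' = pathCoords id γ := by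
      funext t
      exact congrArg Subtype.val (congrFun hΓ (Set.projIcc 0 1 zero_le_one t))
    exact ⟨γ', s, hs, h.symm ▸ hmem, h.symm ▸ hd, by rw [h]⟩

end RiemannianMetricOn

/-! ### Deck transformations and virtually cyclic groups -/

/-- The group of deck transformations of `p`. -/
def deckGroup {E X : Type*} [TopologicalSpace E] (p : E → X) : Subgroup (E ≃ₜ E) where
  carrier := {φ | ∀ x, p (φ x) = p x}
  one_mem' _ := rfl
  mul_mem' {φ ψ} hφ hψ x := (hφ (ψ x)).trans (hψ x)
  inv_mem' {φ} hφ x := by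
    have h := hφ (φ.symm x)
    rw [φ.apply_symm_apply] at h
    exact h.symm

section deckGroup

variable {E X : Type*} [TopologicalSpace E] {p : E → X}

instance : MulAction (deckGroup p) E where
  smul φ x := φ.1 x
  one_smul _ := rfl
  mul_smul _ _ _ := rfl

theorem map_deckGroup_smul (φ : deckGroup p) (x : E) : p (φ • x) = p x := φ.2 x

instance : ContinuousConstSMul (deckGroup p) E := ⟨fun φ => φ.1.continuous⟩

variable [TopologicalSpace X]

theorem IsCoveringMap.exists_deckGroup_smul_eq [SimplyConnectedSpace E]
    [LocallyPathConnectedSpace E] (hp : IsCoveringMap p) {a b : E} (h : p a = p b) :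
    ∃ φ : deckGroup p, φ • a = b := by
  obtain ⟨F, ⟨hFa, hF⟩, -⟩ := hp.existsUnique_continuousMap_lifts ⟨p, hp.continuous⟩ a b h.symm
  obtain ⟨G, ⟨hGb, hG⟩, -⟩ := hp.existsUnique_continuousMap_lifts ⟨p, hp.continuous⟩ b a h
  have hF' : ∀ x, p (F x) = p x := congrFun hF
  have hG' : ∀ x, p (G x) = p x := congrFun hG
  have h1 : (G ∘ F : E → E) = id :=
    hp.eq_of_comp_eq (G.continuous.comp F.continuous) continuous_id
      (funext fun x => (hG' _).trans (hF' x)) a (by simp [hFa, hGb])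
  have h2 : (F ∘ G : E → E) = id :=
    hp.eq_of_comp_eq (F.continuous.comp G.continuous) continuous_id
      (funext fun x => (hF' _).trans (hG' x)) b (by simp [hFa, hGb])
  exact ⟨⟨⟨⟨F, G, congrFun h1, congrFun h2⟩, F.continuous, G.continuous⟩, hF'⟩, hFa⟩

theorem IsCoveringMap.isQuotientCoveringMap_deckGroup [SimplyConnectedSpace E]
    [LocallyPathConnectedSpace E] (hp : IsCoveringMap p) (hs : p.Surjective) :
    IsQuotientCoveringMap p (deckGroup p) := by
  refine (isQuotientCoveringMap_iff_isCoveringMap_and _ _).2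
    ⟨hp, hs, inferInstance, ⟨fun φ ψ x h => ?_⟩, fun {a b} => ⟨fun h => ?_, ?_⟩⟩
  · have : (φ.1 : E → E) = ψ.1 := hp.eq_of_comp_eq φ.1.continuous ψ.1.continuous
      (funext fun y => (φ.2 y).trans (ψ.2 y).symm) x h
    exact Subtype.ext (Homeomorph.ext (congrFun this))
  · exact hp.exists_deckGroup_smul_eq h.symm
  · rintro ⟨φ, rfl⟩
    exact map_deckGroup_smul φ b

end deckGroup

/-- Deck transformations form the opposite of the fundamental group. Passing to the opposite turns a
factorization with the cyclic subgroup on the right into one with the power of `a` on the left. -/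
theorem IsVirtuallyCyclic.exists_zpow_mul {Q : Type*} [Group Q] (h : IsVirtuallyCyclic Q)
    {G : Type*} [Group G] (φ : Q ≃* Gᵐᵒᵖ) :
    ∃ (a : G) (F : Finset G), ∀ g, ∃ n : ℤ, ∃ k ∈ F, g = a ^ n * k := by
  classical
  obtain ⟨H, hH, hfin⟩ := h
  obtain ⟨⟨a, ha⟩, hgen⟩ := hH.exists_generator
  have := Fintype.ofFinite (Q ⧸ H)
  refine ⟨(φ a).unop, Finset.univ.image fun q : Q ⧸ H => (φ q.out).unop, fun g => ?_⟩
  obtain ⟨x, hx⟩ := φ.surjective (MulOpposite.op g)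
  obtain ⟨h, hh⟩ := QuotientGroup.mk_out_eq_mul H x
  obtain ⟨n, hn⟩ := Subgroup.mem_zpowers_iff.1 (hgen h⁻¹)
  have hn' : a ^ n = (h : Q)⁻¹ := congrArg Subtype.val hn
  refine ⟨n, _, Finset.mem_image_of_mem _ (Finset.mem_univ (x : Q ⧸ H)), ?_⟩
  rw [← MulOpposite.unop_zpow, ← MulOpposite.unop_mul, ← map_zpow, ← map_mul, hn', hh,
    mul_inv_cancel_right, hx, MulOpposite.unop_op]

/-! ### Maps to graphs from real functions -/

/-- The complete graph on `W`, as a simplicial complex of dimension one. -/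
def completeComplex (W : Type*) : AbstractSimplicialComplex W where
  faces := {s | s.Nonempty ∧ s.card ≤ 2}
  isRelLowerSet_faces s hs :=
    ⟨hs.1, fun _ hts ht => ⟨ht, (Finset.card_le_card hts).trans hs.2⟩⟩
  singleton_mem v := ⟨Finset.singleton_nonempty v, by simp⟩

namespace completeComplex

variable {W : Type*}

open Classical in
/-- The point dividing the edge from `v` to `v'` in the ratio `c : 1 - c`. -/
noncomputable def edgePoint (v v' : W) (c : unitInterval) : Realization (completeComplex W) :=
  ⟨fun i => (if i = v then 1 - (c : ℝ) else 0) + if i = v' then (c : ℝ) else 0, {v, v'},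
    ⟨⟨v, by simp⟩, Finset.card_le_two⟩, fun i => add_nonneg
      (by split_ifs <;> linarith [c.2.2]) (by split_ifs <;> linarith [c.2.1]),
    fun i hi => by
      simp only [Finset.mem_insert, Finset.mem_singleton, not_or] at hi
      simp [hi.1, hi.2], by
      rw [Finset.sum_add_distrib]
      simp⟩

theorem edgePoint_zero (v v' v'' : W) : edgePoint v v' 0 = edgePoint v v'' 0 := by
  apply Subtype.ext
  funext i
  simp [edgePoint]

theorem edgePoint_one (v v' v'' : W) : edgePoint v v' 1 = edgePoint v' v'' 0 := by
  apply Subtype.ext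
  funext i
  simp [edgePoint]

theorem eq_or_eq_of_edgePoint_ne_zero {v v' i : W} {c : unitInterval}
    (h : (edgePoint v v' c).1 i ≠ 0) : i = v ∨ i = v' ∧ c ≠ 0 := by
  by_contra! hcon
  refine h ?_
  simp only [edgePoint, hcon.1, if_false, zero_add]
  split_ifs with hi
  · simp [hcon.2 hi]
  · rfl

theorem continuous_edgePoint (v v' : W) : Continuous (edgePoint v v') := by
  classical
  have hs : ({v, v'} : Finset W) ∈ completeComplex W := ⟨⟨v, by simp⟩, Finset.card_le_two⟩
  have hmem : ∀ c, (edgePoint v v' c).1 ∈ closedSimplex ({v, v'} : Finset W) := by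
    intro c
    refine ⟨fun i => Realization.coord_nonneg _ i, fun i hi => ?_, ?_⟩
    · simp only [Finset.mem_insert, Finset.mem_singleton, not_or] at hi
      simp [edgePoint, hi.1, hi.2]
    · simp only [edgePoint]
      rw [Finset.sum_add_distrib]
      simp
  refine (Realization.continuous_simplexInclusion ⟨{v, v'}, hs⟩).comp
    (f := fun c => ⟨(edgePoint v v' c).1, hmem c⟩) (Continuous.subtype_mk ?_ _)
  refine continuous_pi fun i => ?_
  simp only [edgePoint]
  split_ifs <;> fun_prop

end completeComplex

theorem Realization.exists_coord_ne_zero {W : Type*} {L : AbstractSimplicialComplex W}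
    (y : Realization L) : ∃ i, y.1 i ≠ 0 := by
  obtain ⟨s, -, hy⟩ := y.2
  by_contra! h
  simpa [h] using hy.2.2

/-- A nonnegative function has a nerve: a map to a graph whose fibers are joined in the preimages
of intervals of length two. -/
theorem exists_nerve_map {X : Type u} [TopologicalSpace X] [LocallyPathConnectedSpace X]
    {h : X → ℝ} (hc : Continuous h) (h0 : ∀ x, 0 ≤ h x) :
    ∃ (W : Type u) (L : AbstractSimplicialComplex W), (∀ s ∈ L, s.card ≤ 2) ∧
      ∃ F : X → Realization L, Continuous F ∧ ∀ x y, F x = F y →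
        ∃ k : ℕ, JoinedIn {z | (k : ℝ) - 1 < h z ∧ h z < k + 1} x y := by
  classical
  let S : ℕ → Set X := fun k => {z | (k : ℝ) - 1 < h z ∧ h z < k + 1}
  have hS : ∀ k, IsOpen (S k) := fun k =>
    (isOpen_lt continuous_const hc).inter (isOpen_lt hc continuous_const)
  let C : ℕ → X → ℕ × Set X := fun k x => (k, pathComponentIn (S k) x)
  have hC : ∀ k x, x ∈ S k → ∀ᶠ y in nhds x, C k y = C k x := by
    intro k x hx
    filter_upwards [((hS k).pathComponentIn x).mem_nhds (mem_pathComponentIn_self hx)] with y hy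
    exact Prod.ext rfl (pathComponentIn_congr hy)
  -- The edge parameter is constant near both ends, so `F` is locally constant near integer levels,
  -- where the floor jumps.
  let r : ℝ → unitInterval := fun t => Set.projIcc 0 1 zero_le_one (2 * t - 1 / 2)
  have hr : Continuous r := continuous_projIcc.comp (by fun_prop)
  have hr0 : ∀ t, t ≤ 1 / 4 → r t = 0 := fun t ht =>
    Set.projIcc_of_le_left _ (by linarith)
  have hr1 : ∀ t, 3 / 4 ≤ t → r t = 1 := fun t ht =>
    Set.projIcc_of_right_le _ (by linarith)
  let F : X → Realization (completeComplex (ℕ × Set X)) := fun x =>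
    completeComplex.edgePoint (C ⌊h x⌋₊ x) (C (⌊h x⌋₊ + 1) x) (r (h x - ⌊h x⌋₊))
  have hFk : ∀ (k : ℕ) x, (k : ℝ) < h x → h x < k + 1 →
      F x = completeComplex.edgePoint (C k x) (C (k + 1) x) (r (h x - k)) := by
    intro k x h1 h2
    have : ⌊h x⌋₊ = k := (Nat.floor_eq_iff (h0 x)).2 ⟨h1.le, h2⟩
    simp only [F, this]
  have hFv : ∀ (k : ℕ) x, (k : ℝ) - 1 / 4 < h x → h x < k + 1 / 4 →
      F x = completeComplex.edgePoint (C k x) (C k x) 0 := by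
    intro k x h1 h2
    rcases le_or_gt (k : ℝ) (h x) with hk | hk
    · have : ⌊h x⌋₊ = k := (Nat.floor_eq_iff (h0 x)).2 ⟨hk, by linarith⟩
      simp only [F, this]
      rw [hr0 _ (by linarith)]
      exact completeComplex.edgePoint_zero _ _ _
    · obtain ⟨m, rfl⟩ : ∃ m, k = m + 1 := by
        refine Nat.exists_eq_succ_of_ne_zero ?_
        rintro rfl
        have := h0 x
        push_cast at hk
        linarith
      push_cast at hk h1
      have : ⌊h x⌋₊ = m := (Nat.floor_eq_iff (h0 x)).2 ⟨by linarith, hk⟩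
      simp only [F, this]
      rw [hr1 _ (by linarith)]
      exact completeComplex.edgePoint_one _ _ _
  refine ⟨ℕ × Set X, completeComplex _, fun s hs => hs.2, F, ?_, ?_⟩
  · refine continuous_iff_continuousAt.2 fun x => ?_
    by_cases hx : ∃ k : ℕ, (k : ℝ) - 1 / 4 < h x ∧ h x < k + 1 / 4
    · obtain ⟨k, h1, h2⟩ := hx
      refine (continuousAt_const (y := F x)).congr ?_
      filter_upwards [hc.continuousAt.eventually (lt_mem_nhds h1),
        hc.continuousAt.eventually (gt_mem_nhds h2), hC k x ⟨by linarith, by linarith⟩]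
        with y hy1 hy2 hy
      rw [hFv k x h1 h2, hFv k y hy1 hy2, hy]
    · have h1 : ((⌊h x⌋₊ : ℕ) : ℝ) < h x := by
        by_contra! hle
        exact hx ⟨⌊h x⌋₊, by linarith [Nat.floor_le (h0 x)], by linarith⟩
      have h2 := Nat.lt_floor_add_one (h x)
      have hcont : Continuous fun y => completeComplex.edgePoint (C ⌊h x⌋₊ x) (C (⌊h x⌋₊ + 1) x)
          (r (h y - ⌊h x⌋₊)) :=
        (completeComplex.continuous_edgePoint _ _).comp (hr.comp (hc.sub continuous_const))
      refine hcont.continuousAt.congr ?_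
      filter_upwards [hc.continuousAt.eventually (lt_mem_nhds h1),
        hc.continuousAt.eventually (gt_mem_nhds h2), hC ⌊h x⌋₊ x ⟨by linarith, by linarith⟩,
        hC (⌊h x⌋₊ + 1) x ⟨by push_cast; linarith, by push_cast; linarith⟩] with y hy1 hy2 hy hy'
      rw [hFk _ y hy1 hy2, hy, hy']
  -- A vertex with nonzero coordinate at `F x` determines a level `k` and the component of `S k`
  -- containing `x`. Points with equal image share such a vertex.
  · have key : ∀ x k T, (F x).1 (k, T) ≠ 0 → x ∈ S k ∧ T = pathComponentIn (S k) x := by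
      intro x k T hne
      have h1 := Nat.floor_le (h0 x)
      have h2 := Nat.lt_floor_add_one (h x)
      rcases completeComplex.eq_or_eq_of_edgePoint_ne_zero hne with heq | ⟨heq, hne0⟩
      · obtain ⟨rfl, rfl⟩ := Prod.mk.inj heq
        exact ⟨⟨by linarith, by linarith⟩, rfl⟩
      · obtain ⟨rfl, rfl⟩ := Prod.mk.inj heq
        have h3 : 1 / 4 < h x - ⌊h x⌋₊ := by
          by_contra! hle
          exact hne0 (hr0 _ hle)
        exact ⟨⟨by push_cast; linarith, by push_cast; linarith⟩, rfl⟩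
    intro x y hxy
    obtain ⟨⟨k, T⟩, hne⟩ := (F x).exists_coord_ne_zero
    obtain ⟨hx, hxT⟩ := key x k T hne
    obtain ⟨hy, hyT⟩ := key y k T (hxy ▸ hne)
    have hmem : y ∈ pathComponentIn (S k) x := by
      rw [← hxT, hyT]
      exact mem_pathComponentIn_self hy
    exact ⟨k, hmem⟩

/-! ### Proof of the width inequality -/

namespace RiemannianMetricOn

variable {V : Type u} [Fintype V] {K : AbstractSimplicialComplex V} {g : RiemannianMetricOn K}
  {E : Type w} [TopologicalSpace E] {p : E → Realization K}

/-- The width concerns maps continuous for the metric, whereas lifting and medians use the given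
topology of `E`. -/
theorem continuous_of_continuous_lengthSpace {T : Type*} [TopologicalSpace T]
    (hp : IsLocalHomeomorph p) {f : E → T} (hf : Continuous (X := g.LengthSpace p) f) :
    Continuous f := by
  refine continuous_def.2 fun U hU => isOpen_iff_mem_nhds.2 fun x hx => ?_
  obtain ⟨ε, hε, h⟩ := EMetric.isOpen_iff.1 (hU.preimage hf) x hx
  refine Filter.mem_of_superset ((isOpen_pathEDist_lt (g := g) hp x ε).mem_nhds
    (by simpa [pathEDist_self] using hε)) fun y hy => h ?_
  change g.pathEDist p y x < ε
  rw [pathEDist_comm]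
  exact hy

theorem continuous_lengthSpace_id {T : Type*} [TopologicalSpace T] {f : Realization K → T}
    (hf : Continuous f) : Continuous (X := g.LengthSpace id) f := by
  obtain ⟨C, hC, h⟩ := g.exists_norm_sub_le
  have hl : LipschitzWith C.toNNReal fun x : g.LengthSpace (id : Realization K → _) =>
      (Subtype.val x : V → ℝ) := by
    intro x y
    rw [edist_dist, dist_eq_norm]
    exact h (p := id) x y
  have : Continuous (X := g.LengthSpace id) (Y := Realization K) fun x => x :=
    (Realization.isEmbedding_val K).continuous_iff.2 hl.continuous
  exact hf.comp this

theorem exists_separating_center [SimplyConnectedSpace E] [LocallyPathConnectedSpace E]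
    [ConnectedSpace (Realization K)] {x₀ : Realization K}
    (hπ : IsVirtuallyCyclic (FundamentalGroup (Realization K) x₀))
    (hp : IsCoveringMap p) (hs : p.Surjective) {W : Type*} {L : AbstractSimplicialComplex W}
    (hL : ∀ s ∈ L, s.card ≤ 2) {f : E → Realization L} (hf : Continuous f) {w R ε : ℝ}
    (hw : ∀ x y, f x = f y → (g.pathEDist p x y).toReal ≤ w) (hw0 : 0 ≤ w) (hwR : w < R)
    (hε : 0 < ε) : ∃ c : E, ∀ q₁ ∈ p ⁻¹' {p c}, ∀ q₂ ∈ p ⁻¹' {p c}, ∀ q₃ ∈ p ⁻¹' {p c},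
      2 * R + ε ≤ (g.pathEDist p q₁ q₂).toReal → 2 * R + ε ≤ (g.pathEDist p q₁ q₃).toReal →
      2 * R + ε ≤ (g.pathEDist p q₂ q₃).toReal →
      (∀ γ : Path q₂ q₃, ∃ t, (g.pathEDist p q₁ (γ t)).toReal < R) ∨
      (∀ γ : Path q₁ q₃, ∃ t, (g.pathEDist p q₂ (γ t)).toReal < R) ∨
        ∀ γ : Path q₁ q₂, ∃ t, (g.pathEDist p q₃ (γ t)).toReal < R := by
  have hD := isLengthDist (g := g) hp.isLocalHomeomorph
  have hG : ∀ (φ : deckGroup p) a b, (g.pathEDist p (φ • a) (φ • b)).toReal =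
      (g.pathEDist p a b).toReal := by
    intro φ a b
    congr 1
    refine le_antisymm (pathEDist_map_le φ.1.continuous φ.2 a b) ?_
    have h := pathEDist_map_le (g := g) (φ⁻¹).1.continuous (φ⁻¹).2 (φ • a) (φ • b)
    change g.pathEDist p (φ⁻¹ • φ • a) (φ⁻¹ • φ • b) ≤ _ at h
    rwa [inv_smul_smul, inv_smul_smul] at h
  have hq := hp.isQuotientCoveringMap_deckGroup hs
  have horb : ∀ c, p ⁻¹' {p c} = MulAction.orbit (deckGroup p) c := by
    intro c
    ext q
    exact hq.apply_eq_iff_mem_orbit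
  simp only [horb]
  obtain ⟨e, rfl⟩ := hs x₀
  obtain ⟨a, F, hF⟩ := hπ.exists_zpow_mul (hq.fundamentalGroupEquiv ⟨e, rfl⟩)
  by_cases ha : IsOfFinOrder a
  · have : Finite (deckGroup p) := by
      have hfin : (Set.range fun n : ℤ => a ^ n).Finite := by
        rw [← Subgroup.coe_zpowers]
        exact finite_zpowers.2 ha
      refine Set.finite_univ_iff.1 ((hfin.mul F.finite_toSet).subset fun φ _ => ?_)
      obtain ⟨n, k, hk, rfl⟩ := hF φ
      exact Set.mul_mem_mul ⟨n, rfl⟩ hk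
    exact hD.exists_separating_center_of_finite hG hL hf hw hw0 hwR hε
  · refine hD.exists_separating_center_of_infinite hG hL hf hw hw0 hwR hε (e := e) (a := a)
      (fun B => ?_) hF
    have hcancel := hq.isCancelSMul
    have hinj : Function.Injective fun m : ℤ => a ^ m • e := fun m n h =>
      injective_zpow_iff_not_isOfFinOrder.2 ha (IsCancelSMul.right_cancel _ _ e h)
    -- Properness: the points `a ^ m • e` are distinct and lie in one fiber of `p`, which meets each
    -- ball in a finite set.
    have hfin : {m : ℤ | (g.pathEDist p e (a ^ m • e)).toReal ≤ B}.Finite := by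
      refine Set.Finite.of_finite_image (f := fun m : ℤ => a ^ m • e)
        ((finite_fiber_inter_ball (g := g) hp e (p e) (B + 1)).subset ?_) hinj.injOn
      rintro _ ⟨m, hm, rfl⟩
      have hm' : (g.pathEDist p e (a ^ m • e)).toReal ≤ B := hm
      exact ⟨map_deckGroup_smul _ _, by linarith⟩
    obtain ⟨N, hN⟩ := (hfin.image Int.natAbs).bddAbove
    refine ⟨N + 1, fun m hm => ?_⟩
    by_contra! hle
    have := hN ⟨m, hle, rfl⟩
    omega

theorem urysonWidth_id_le [SimplyConnectedSpace E] [ConnectedSpace (Realization K)]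
    {x₀ : Realization K} (hπ : IsVirtuallyCyclic (FundamentalGroup (Realization K) x₀))
    (hp : IsCoveringMap p) {W : Type*} {L : AbstractSimplicialComplex W}
    (hL : ∀ s ∈ L, s.card ≤ 2) {f : E → Realization L} (hf : Continuous f) {w δ : ℝ}
    (hw0 : 0 ≤ w) (hw : ∀ x y, f x = f y → (g.pathEDist p x y).toReal ≤ w) (hδ : 0 < δ) :
    urysonWidth 1 (g.LengthSpace (id : Realization K → _)) ≤ ENNReal.ofReal (6 * w + 6 * δ) := by
  have hlX := Realization.locallyPathConnectedSpace K
  have hlE := hp.isLocalHomeomorph.locallyPathConnectedSpace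
  have hpX : PathConnectedSpace (Realization K) := .of_locallyPathConnectedSpace
  have hs : p.Surjective := by
    intro x
    obtain ⟨e⟩ : Nonempty E := inferInstance
    obtain ⟨Γ, hΓ, -⟩ := hp.exists_path_lifts (PathConnectedSpace.somePath (p e) x).toContinuousMap
      e (by simp)
    exact ⟨Γ 1, (congrFun hΓ 1).trans (Path.target _)⟩
  obtain ⟨c, hsep⟩ := exists_separating_center (g := g) hπ hp hs hL hf hw hw0
    (R := w + δ) (ε := δ) (by linarith) hδ
  have hD := isLengthDist (g := g) hp.isLocalHomeomorph
  have hid : IsLocalHomeomorph (id : Realization K → _) := (Homeomorph.refl _).isLocalHomeomorph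
  have hX := isLengthDist (g := g) hid
  set D : E → E → ℝ := fun a b => (g.pathEDist p a b).toReal
  set d : Realization K → Realization K → ℝ := fun a b => (g.pathEDist id a b).toReal
  have hdD : ∀ a b, d (p a) (p b) ≤ D a b := fun a b =>
    ENNReal.toReal_mono (pathEDist_ne_top hp.isLocalHomeomorph a b)
      (pathEDist_map_le hp.continuous (fun _ => rfl) a b)
  -- Rescaling by `δ / 2` turns the intervals of length two into slabs of thickness `δ`.
  obtain ⟨W', L', hL', F, hF, hFk⟩ := exists_nerve_map
    (h := fun x => d (p c) x / (δ / 2)) ((hX.continuous _).div_const _)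
    (fun x => div_nonneg (hX.nonneg _ _) (by positivity))
  have : PathConnectedSpace unitInterval := isPathConnected_iff_pathConnectedSpace.1
    ((convex_Icc (0 : ℝ) 1).isPathConnected ⟨0, le_rfl, zero_le_one⟩)
  have hη : 0 < δ / 2 := by positivity
  have hmain : ∀ x y, F x = F y → d x y ≤ 6 * w + 6 * δ := by
    intro x y hxy
    obtain ⟨k, γ, hγ⟩ := hFk x y hxy
    have hγ1 : ∀ t, ((k : ℝ) - 1) * (δ / 2) < d (p c) (γ t) := fun t =>
      (lt_div_iff₀ hη).1 (hγ t).1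
    have hγ2 : ∀ t, d (p c) (γ t) < (k + 1) * (δ / 2) := fun t =>
      (div_lt_iff₀ hη).1 (hγ t).2
    -- The maximum with `0` only matters at the lowest level `k = 0`, where the interval starts
    -- below `0`.
    obtain ⟨r, hr⟩ : ∃ r, r = max (((k : ℝ) - 1) * (δ / 2)) 0 := ⟨_, rfl⟩
    have hr1 : ∀ t, r ≤ d (p c) (γ t) := fun t =>
      hr ▸ max_le (hγ1 t).le (hX.nonneg _ _)
    have hr2 : ∀ t, d (p c) (γ t) < r + δ := fun t => by
      have := le_max_left (((k : ℝ) - 1) * (δ / 2)) 0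
      rw [← hr] at this
      linarith [hγ2 t]
    have hdx := hr2 0
    have hdy := hr2 1
    rw [γ.source] at hdx
    rw [γ.target] at hdy
    -- Close to `p c`, going through `p c` costs less than `2 * (r + δ) < 4 * w + 6 * δ`; farther
    -- out, the lifted path is a slab.
    rcases lt_or_ge r (2 * w + 2 * δ) with hlt | hge
    · linarith [hX.triangle x (p c) y, hX.symm x (p c)]
    obtain ⟨z, rfl⟩ := hs x
    obtain ⟨Γ, hΓ, hΓ0⟩ := hp.exists_path_lifts γ.toContinuousMap z (by simp)
    have hΓt : ∀ t, p (Γ t) = γ t := congrFun hΓ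
    have hslab : IsSlab D f w δ r (fun x => d (p c) (p x)) (p ⁻¹' {p c}) (Set.range Γ) := by
      refine ⟨hD, hw, fun x q hq => ?_, fun x y => ?_, fun {x ℓ} hℓ => ?_,
        isPathConnected_range Γ.continuous, ?_, ?_⟩
      · rw [hX.symm, ← show p q = p c from hq]
        exact hdD x q
      · have h1 := hX.triangle (p c) (p y) (p x)
        have h2 := hdD x y
        rw [hX.symm] at h2
        linarith
      · have h1 : g.pathEDist id (p x) (p c) < ENNReal.ofReal ℓ := by
          rw [pathEDist_comm]
          exact (ENNReal.lt_ofReal_iff_toReal_lt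
            (pathEDist_ne_top hid _ _)).2 hℓ
        obtain ⟨ℓ', hlt, hℓ'⟩ := exists_isPathLength_of_pathEDist_lt h1
        obtain ⟨q, hq, hpath⟩ := hℓ'.exists_lift hp x rfl
        refine ⟨q, hq, (ENNReal.lt_ofReal_iff_toReal_lt
          (pathEDist_ne_top hp.isLocalHomeomorph _ _)).1 (hpath.pathEDist_le.trans_lt hlt)⟩
      · rintro _ ⟨t, rfl⟩
        simpa only [hΓt] using hr1 t
      · rintro _ ⟨t, rfl⟩
        simpa only [hΓt] using hr2 t
    have h1 := hslab.dist_le hL hf hge (fun q₁ h₁ q₂ h₂ q₃ h₃ h12 h13 h23 =>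
      hsep q₁ h₁ q₂ h₂ q₃ h₃ (by linarith) (by linarith) (by linarith)) ⟨0, rfl⟩ ⟨1, rfl⟩
    have h2 := hdD (Γ 0) (Γ 1)
    rw [hΓt, hΓt, γ.source, γ.target] at h2
    linarith
  refine sInf_le ⟨W', L', hL', F, continuous_lengthSpace_id hF, fun y => ?_⟩
  refine Metric.ediam_le fun a ha b hb => ?_
  change g.pathEDist id a b ≤ _
  rw [← ENNReal.ofReal_toReal (pathEDist_ne_top (E := Realization K) hid a b)]
  exact ENNReal.ofReal_le_ofReal
    (hmain a b ((show F a = y from ha).trans (show F b = y from hb).symm))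

end RiemannianMetricOn

/-- `(K, g)` is a connected compact Riemannian polyhedron with virtually cyclic fundamental group
and `p : E → |K|` is its universal cover. -/
theorem theoremA {V : Type u} [Fintype V] (K : AbstractSimplicialComplex V)
    [ConnectedSpace (Realization K)] (g : RiemannianMetricOn K) (x₀ : Realization K)
    (hπ : IsVirtuallyCyclic (FundamentalGroup (Realization K) x₀))
    {E : Type w} [TopologicalSpace E] [SimplyConnectedSpace E]
    (p : E → Realization K) (hp : IsCoveringMap p) :
    urysonWidth 1 (g.LengthSpace id) ≤ 6 * urysonWidth 1 (g.LengthSpace p) := by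
  rw [mul_comm, ← ENNReal.div_le_iff (by norm_num) (by norm_num)]
  refine le_sInf fun ε hε => ?_
  rw [ENNReal.div_le_iff (by norm_num) (by norm_num), mul_comm]
  obtain ⟨W, L, hL, f, hf, hfib⟩ := hε
  rcases eq_or_ne ε ⊤ with rfl | hε
  · simp
  have hw : ∀ x y, f x = f y → (g.pathEDist p x y).toReal ≤ ε.toReal := by
    intro x y hxy
    refine ENNReal.toReal_mono hε (le_trans ?_ (hfib (f y)))
    exact Metric.edist_le_ediam_of_mem (X := g.LengthSpace p) (x := x) (y := y) hxy rfl
  refine ENNReal.le_of_forall_pos_le_add fun δ hδ _ => ?_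
  refine (RiemannianMetricOn.urysonWidth_id_le hπ hp hL
    (RiemannianMetricOn.continuous_of_continuous_lengthSpace hp.isLocalHomeomorph hf)
    ENNReal.toReal_nonneg hw (δ := δ / 6) (by positivity)).trans ?_
  rw [ENNReal.ofReal_add (by positivity) (by positivity), ENNReal.ofReal_mul (by norm_num),
    ENNReal.ofReal_toReal hε, mul_div_cancel₀ _ (by norm_num)]
  simp
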